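/- **Setting.** Let $X=(X,d,\mu)$ be a metric space with at least two points, equipped with a Borel regular measure $\mu$ such that $0<\mu(B)<\infty$ and $\mu(2B)\le D\,\mu(B)$ for some $D>1$ and all open balls $B=B(x,r)$, $r>0$, where $\lambda B=B(x,\lambda r)$. A *curve* is a continuous rectifiable map $\gamma\colon[a,b]\to X$, with length $\ell(\gamma)$; line integrals $\int_\gamma g\,ds$ are taken with respect to arc length. Assume that $X$ is $C_{\mathrm{QC}}$-quasiconvex for some $C_{\mathrm{QC}}\ge1$: any $x,y\in X$ are connected by a curve of length at most $C_{\mathrm{QC}}\,d(x,y)$. For $x,y\in X$, $E\subset X$ and $\nu\ge1$ let $\Gamma^\nu_{x,y}$ be the set of curves from $x$ to $y$ of length at most $\nu d(x,y)$, and $\Gamma^\nu_{x,E}$ the set of curves from $x$ to a point of $E$ of length at most $\nu d(x,E)$. Let $LC(X)$ be the set of lower semicontinuous functions $g\colon X\to\mathbb R$. Let $\Omega\subsetneq X$ be a nonempty open set and $\Omega^c=X\setminus\Omega$. A *weight for $\Omega$* is a Borel function $w\colon X\to[0,\infty]$ with $\int_B w\,d\mu<\infty$ for all balls $B$ and $w>0$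 almost everywhere in $\Omega$; write $w(E)=\int_E w\,d\mu$. The weight $w$ is *semilocally doubling* for $\Omega$ if for every $\kappa>0$ there is a constant $D(w,\kappa)\ge1$ with $$0<w(B(x,r))\le D(w,\kappa)\,w(B(x,r/2))<\infty\qquad\text{for all }x\in\Omega,\ 0<r\le\kappa\, d(x,\Omega^c).$$ For $1\le p<\infty$, $\kappa>0$ and $x\in\Omega$ let $$\mathcal M_{p,w,\kappa}f(x)=\sup_{0<r<\kappa d(x,\Omega^c)}\Bigl(\frac1{w(B(x,r))}\int_{B(x,r)}|f|^pw\,d\mu\Bigr)^{1/p},$$ and let $\mathcal M^R_{p,w,\kappa}f(x)$ be the same supremum over $0<r<\min\{\kappa d(x,\Omega^c),R\}$ (a supremum over the empty set is $0$). * $w$ is a *$p$-Poincaré weight for $\Omega$* if there are $C_{\mathrm A}>0$, $\nu>C_{\mathrm{QC}}$ and $\kappa>1$ such that for all non-negative bounded $g\in LC(X)$ and all $x,y\in\Omega$ with $d(x,y)<d(x,\Omega^c)/(3\kappa)$, $$\inf_{\gamma\in\Gamma^\nu_{x,y}}\int_\gamma g\,ds\le C_{\mathrm A}\,d(x,y)\bigl(\mathcal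 M^{\kappa d(x,y)}_{p,w,\kappa}g(x)+\mathcal M^{\kappa d(x,y)}_{p,w,\kappa}g(y)\bigr).$$ * $w$ is a *$p$-Hardy weight for $\Omega$* if there are $C_\Gamma>0$, $\nu>C_{\mathrm{QC}}$ and $\kappa>1$ such that for all non-negative bounded $g\in LC(X)$ and all $x\in\Omega$, $$\inf_{\gamma\in\Gamma^\nu_{x,\Omega^c}}\int_\gamma g\,ds\le C_\Gamma\,d(x,\Omega^c)\,\mathcal M_{p,w,\kappa}g(x).$$ * For $\nu>C_{\mathrm{QC}}$, $\kappa>1$ and $\tau\ge0$, $$\alpha_{p,w,\Omega}(\nu,\kappa,\tau)=\sup_{x\in\Omega}\ \sup_{g}\ \frac{\inf_{\gamma\in\Gamma^\nu_{x,\Omega^c}}\int_\gamma g\,ds}{d(x,\Omega^c)},$$ where the inner supremum is over all $g\in LC(X)$ with values in $[0,1]$ and $\mathcal M_{p,w,\kappa}g(x)\le\tau$. **Theorem.** Let $1<p_0<p<\infty$, let $\Omega\subsetneq X$ be a nonempty open set and let $w$ be a semilocally doubling weight for $\Omega$. Assume that $w$ is a $p_0$-Poincaré weight for $\Omega$ and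 a $p$-Hardy weight for $\Omega$. Then there exist an exponent $q\in(p_0,p)$ and constants $N>C_{\mathrm{QC}}$, $K>1$ and $C_\alpha>0$ such that $$\alpha_{q,w,\Omega}(N,K,\tau)\le C_\alpha\,\tau\qquad\text{for all }\tau\ge0,$$ and $w$ is a $q$-Hardy weight for $\Omega$. Moreover, there are constants $\nu>C_{\mathrm{QC}}$, $\kappa>1$ and $C>0$ such that $\alpha_{p,w,\Omega}(\nu,\kappa,\tau)\le C\,\tau$ for all $\tau\ge0$. -/

import Mathlib

open Set MeasureTheory
open scoped ENNReal

/-- A doubling measure in the quantitative sense: every open ball has positive and finite measure,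
and `μ (2B) ≤ D μ (B)` for all balls `B`. -/
def IsDoublingMeasure {X : Type*} [MetricSpace X] [MeasurableSpace X]
    (μ : Measure X) (D : ℝ) : Prop :=
  ∀ (x : X) (r : ℝ), 0 < r →
    0 < μ (Metric.ball x r) ∧ μ (Metric.ball x r) < ∞ ∧
      μ (Metric.ball x (2 * r)) ≤ ENNReal.ofReal D * μ (Metric.ball x r)

/-- A curve in `X`: a rectifiable continuous map on a compact interval `[a, b]`. Values of `toFun`
outside `[a, b]` are irrelevant. -/
structure RectCurve (X : Type*) [MetricSpace X] where
  /-- left end point of the parameter interval -/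
  a : ℝ
  /-- right end point of the parameter interval -/
  b : ℝ
  hab : a ≤ b
  /-- the parametrization -/
  toFun : ℝ → X
  continuousOn : ContinuousOn toFun (Icc a b)
  rectifiable : eVariationOn toFun (Icc a b) ≠ ∞

namespace RectCurve

variable {X : Type*} [MetricSpace X]

/-- The length of a curve. -/
noncomputable def length (γ : RectCurve X) : ℝ≥0∞ := eVariationOn γ.toFun (Icc γ.a γ.b)

/-- The arc length reparametrization of a curve, which matters on `[0, length γ]` only. -/
noncomputable def arcParam (γ : RectCurve X) : ℝ → X :=
  naturalParameterization γ.toFun (Icc γ.a γ.b) γ.a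

/-- The line integral `∫_γ g ds` of a non-negative function `g`, computed in the arc length
parametrization. -/
noncomputable def lineIntegral (γ : RectCurve X) (g : X → ℝ) : ℝ≥0∞ :=
  ∫⁻ t in Icc (0 : ℝ) γ.length.toReal, ENNReal.ofReal (g (γ.arcParam t))

end RectCurve

/-- The curves that connect `x` to `y` and have length at most `ν d(x, y)`. -/
def curvesToPoint {X : Type*} [MetricSpace X] (ν : ℝ) (x y : X) : Set (RectCurve X) :=
  {γ | γ.toFun γ.a = x ∧ γ.toFun γ.b = y ∧ γ.length ≤ ENNReal.ofReal (ν * dist x y)}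

/-- The curves that connect `x` to the set `E` and have length at most `ν d(x, E)`. -/
def curvesToSet {X : Type*} [MetricSpace X] (ν : ℝ) (x : X) (E : Set X) : Set (RectCurve X) :=
  {γ | γ.toFun γ.a = x ∧ γ.toFun γ.b ∈ E ∧ γ.length ≤ ENNReal.ofReal (ν * Metric.infDist x E)}

/-- `X` is `C`-quasiconvex: any two points `x, y` are connected by a curve of length at most
`C d(x, y)`. -/
def IsQuasiconvexSpace (X : Type*) [MetricSpace X] (C : ℝ) : Prop :=
  ∀ x y : X, (curvesToPoint C x y).Nonempty

section Weights

variable {X : Type*} [MetricSpace X] [MeasurableSpace X]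

/-- The weighted measure `w(E) = ∫_E w dμ`. -/
noncomputable def weightOf (μ : Measure X) (w : X → ℝ≥0∞) (E : Set X) : ℝ≥0∞ :=
  ∫⁻ y in E, w y ∂μ

/-- `w` is a weight for `Ω`: a non-negative Borel function on `X` that is integrable over every ball
and positive almost everywhere in `Ω`. -/
structure IsWeight (μ : Measure X) (Ω : Set X) (w : X → ℝ≥0∞) : Prop where
  measurable : Measurable w
  ball_lt_top : ∀ (x : X) (r : ℝ), 0 < r → weightOf μ w (Metric.ball x r) < ∞
  pos_ae : ∀ᵐ x ∂μ, x ∈ Ω → 0 < w x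

/-- `w` is a semilocally doubling weight for `Ω`. -/
structure IsSemilocallyDoubling (μ : Measure X) (Ω : Set X) (w : X → ℝ≥0∞) : Prop where
  isWeight : IsWeight μ Ω w
  doubling : ∀ κ : ℝ, 0 < κ → ∃ D : ℝ, 1 ≤ D ∧
    ∀ x ∈ Ω, ∀ r : ℝ, 0 < r → r ≤ κ * Metric.infDist x Ωᶜ →
      0 < weightOf μ w (Metric.ball x r) ∧
      weightOf μ w (Metric.ball x r) ≤
        ENNReal.ofReal D * weightOf μ w (Metric.ball x (r / 2)) ∧
      ENNReal.ofReal D * weightOf μ w (Metric.ball x (r / 2)) < ∞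

/-- The weighted `L^p`-average `(w(B)⁻¹ ∫_B |f|^p w dμ)^(1/p)` over the ball `B = B(x, r)`. -/
noncomputable def weightedAverage (μ : Measure X) (w : X → ℝ≥0∞) (p : ℝ) (f : X → ℝ)
    (x : X) (r : ℝ) : ℝ≥0∞ :=
  ((∫⁻ y in Metric.ball x r, ‖f y‖ₑ ^ p * w y ∂μ) / weightOf μ w (Metric.ball x r)) ^ (1 / p)

/-- The restricted weighted maximal function `M_{p,w,κ} f (x)`, with radii `0 < r < κ d(x, Ωᶜ)`. -/
noncomputable def maximalFunction (μ : Measure X) (Ω : Set X) (w : X → ℝ≥0∞) (p κ : ℝ)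
    (f : X → ℝ) (x : X) : ℝ≥0∞ :=
  ⨆ (r : ℝ) (_ : 0 < r ∧ r < κ * Metric.infDist x Ωᶜ), weightedAverage μ w p f x r

/-- The restricted weighted maximal function `M^R_{p,w,κ} f (x)`, with radii
`0 < r < min {κ d(x, Ωᶜ), R}`. -/
noncomputable def maximalFunctionUpTo (μ : Measure X) (Ω : Set X) (w : X → ℝ≥0∞) (p κ R : ℝ)
    (f : X → ℝ) (x : X) : ℝ≥0∞ :=
  ⨆ (r : ℝ) (_ : 0 < r ∧ r < min (κ * Metric.infDist x Ωᶜ) R), weightedAverage μ w p f x r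

/-- `w` is a `p`-Poincaré weight for `Ω`; `Cqc` is the quasiconvexity constant of the space. -/
def IsPoincareWeight (μ : Measure X) (Cqc : ℝ) (Ω : Set X) (w : X → ℝ≥0∞) (p : ℝ) : Prop :=
  IsWeight μ Ω w ∧
  ∃ CA ν κ : ℝ, 0 < CA ∧ Cqc < ν ∧ 1 < κ ∧
    ∀ g : X → ℝ, LowerSemicontinuous g → (∀ y, 0 ≤ g y) → BddAbove (range g) →
      ∀ x ∈ Ω, ∀ y ∈ Ω, dist x y < Metric.infDist x Ωᶜ / (3 * κ) →
        (⨅ γ ∈ curvesToPoint ν x y, γ.lineIntegral g) ≤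
          ENNReal.ofReal CA * ENNReal.ofReal (dist x y) *
            (maximalFunctionUpTo μ Ω w p κ (κ * dist x y) g x +
              maximalFunctionUpTo μ Ω w p κ (κ * dist x y) g y)

/-- `w` is a `p`-Hardy weight for `Ω`; `Cqc` is the quasiconvexity constant of the space. -/
def IsHardyWeight (μ : Measure X) (Cqc : ℝ) (Ω : Set X) (w : X → ℝ≥0∞) (p : ℝ) : Prop :=
  IsWeight μ Ω w ∧
  ∃ CΓ ν κ : ℝ, 0 < CΓ ∧ Cqc < ν ∧ 1 < κ ∧
    ∀ g : X → ℝ, LowerSemicontinuous g → (∀ y, 0 ≤ g y) → BddAbove (range g) →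
      ∀ x ∈ Ω,
        (⨅ γ ∈ curvesToSet ν x Ωᶜ, γ.lineIntegral g) ≤
          ENNReal.ofReal CΓ * ENNReal.ofReal (Metric.infDist x Ωᶜ) *
            maximalFunction μ Ω w p κ g x

/-- The class of lower semicontinuous `g : X → [0, 1]` with `M_{p,w,κ} g (x) ≤ τ`. -/
def testClass (μ : Measure X) (Ω : Set X) (w : X → ℝ≥0∞) (p κ τ : ℝ) (x : X) : Set (X → ℝ) :=
  {g | LowerSemicontinuous g ∧ maximalFunction μ Ω w p κ g x ≤ ENNReal.ofReal τ ∧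
    ∀ y, g y ∈ Icc (0 : ℝ) 1}

/-- The function `α_{p,w,Ω}(ν, κ, τ)`. -/
noncomputable def alphaFunction (μ : Measure X) (Ω : Set X) (w : X → ℝ≥0∞) (p ν κ τ : ℝ) :
    ℝ≥0∞ :=
  ⨆ x ∈ Ω, ⨆ g ∈ testClass μ Ω w p κ τ x,
    (⨅ γ ∈ curvesToSet ν x Ωᶜ, γ.lineIntegral g) / ENNReal.ofReal (Metric.infDist x Ωᶜ)

end Weights

/-!
The idea is to estimate `α_q` recursively, with `q` slightly below `p`. Given a test function `g`
with values in `[0, 1]` and `M_q g (x) ≤ τ`, consider the open sets `E_i` (`highSet`) on which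
local `q`-averages of `g` exceed `M ^ i τ`, for `1 ≤ i ≤ k`. By a weak type estimate
(`measure_highSet_inter_ball_le`) the density of `E_i` in balls around `x` is at most a constant
times `M ^ (-i q)`. If `q` is so close to `p` that `M ^ (k (p - q)) ≤ 2`, then the function
`h = ∑ M ^ i 1_{E_i}` has `M_p h (x) ≲ k ^ (1 / p)`. The `p`-Hardy inequality for `h` gives a curve
from `x` to the boundary with `∑ M ^ i ℓ(γ ∩ E_i) ≲ k ^ (1 / p) d(x, Ωᶜ)`, so one of the `k`
summands is at most a small multiple `δ d(x, Ωᶜ)`, since `p > 1` and `k` is large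
(`exists_path_avoiding_highSet`).

Outside `E_i` the function `g` is at most `M ^ i τ` along the curve, by lower semicontinuity. The
pieces of the curve inside `E_i` have end points at which the `q`-averages of `g` are at most
`M ^ i τ`; a piece that is short compared to the distance to the boundary is replaced by a curve
from the `p₀`-Poincaré inequality (`joinedWithCost_of_poincare`), and only finitely many pieces
have to be replaced because `g ≤ 1` (`exists_joinedWithCost_until`). If a long piece occurs, then
the curve is left at the beginning `y` of the first such piece. Since
`d(y, Ωᶜ) ≲ δ M ^ (-i) d(x, Ωᶜ)`, and `g` is a test function at `y` of level `M ^ i τ`, continuing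
with a curve for the pair `(y, M ^ i τ)` costs at most half of what is allowed. This is
`boundaryCostLE_step`: a linear bound for `α_q` at the levels `M ^ i τ`, `1 ≤ i ≤ k`, implies the
same bound at `τ`. For `τ ≥ 1` the bound holds by quasiconvexity (`boundaryCostLE_of_one_le`),
hence it holds for all `τ > 0`. A linear bound for `α` is equivalent to the Hardy inequality by
scaling (`hardy_of_alphaFunction_le`, `alphaFunction_le_of_hardy`).
-/

/-! ### Curves parametrized by arc length -/

section Curves

open Filter Topology

theorem HasUnitSpeedOn.congr {E : Type*} [PseudoEMetricSpace E] {f g : ℝ → E} {s : Set ℝ}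
    (hf : HasUnitSpeedOn f s) (h : EqOn f g s) : HasUnitSpeedOn g s := by
  intro x hx y hy
  rw [← hf hx hy]
  exact eVariationOn.congr fun t ht => (h ht.1).symm

theorem HasUnitSpeedOn.mono_Icc {E : Type*} [PseudoEMetricSpace E] {f : ℝ → E} {a b c d : ℝ}
    (hf : HasUnitSpeedOn f (Icc a b)) (hac : a ≤ c) (hdb : d ≤ b) :
    HasUnitSpeedOn f (Icc c d) := by
  intro x hx y hy
  rw [← hf ⟨hac.trans hx.1, hx.2.trans hdb⟩ ⟨hac.trans hy.1, hy.2.trans hdb⟩]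
  congr 1
  ext t
  simp only [mem_inter_iff, mem_Icc] at *
  constructor
  · rintro ⟨⟨h1, h2⟩, h3, h4⟩
    exact ⟨⟨by linarith, by linarith⟩, h3, h4⟩
  · rintro ⟨⟨h1, h2⟩, h3, h4⟩
    exact ⟨⟨by linarith, by linarith⟩, h3, h4⟩

theorem HasUnitSpeedOn.comp_add_const {E : Type*} [PseudoEMetricSpace E] {f : ℝ → E} {a b : ℝ}
    (c : ℝ) (hf : HasUnitSpeedOn f (Icc (a + c) (b + c))) :
    HasUnitSpeedOn (fun t => f (t + c)) (Icc a b) := by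
  intro x hx y hy
  have h := hf (x := x + c) ⟨by linarith [hx.1], by linarith [hx.2]⟩ (y := y + c)
    ⟨by linarith [hy.1], by linarith [hy.2]⟩
  have e : Icc (a + c) (b + c) ∩ Icc (x + c) (y + c) = (fun t => t + c) '' (Icc a b ∩ Icc x y) := by
    rw [Icc_inter_Icc, Icc_inter_Icc, image_add_const_Icc, max_add_add_right, min_add_add_right]
  rw [e, ← eVariationOn.comp_eq_of_monotoneOn f (fun t => t + c)
    (fun s _ t _ hst => by simpa using hst)] at h
  rw [show y + c - (x + c) = y - x by ring] at h
  exact h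

variable {X : Type*} [MetricSpace X]

theorem HasUnitSpeedOn.dist_le {f : ℝ → X} {a b s t : ℝ} (hf : HasUnitSpeedOn f (Icc a b))
    (has : a ≤ s) (hst : s ≤ t) (htb : t ≤ b) : dist (f s) (f t) ≤ t - s := by
  have hs : s ∈ Icc a b := ⟨has, hst.trans htb⟩
  have ht : t ∈ Icc a b := ⟨has.trans hst, htb⟩
  have h1 := eVariationOn.edist_le f (s := Icc a b ∩ Icc s t) ⟨hs, le_rfl, hst⟩ ⟨ht, hst, le_rfl⟩
  rw [hf hs ht, NNReal.coe_one, one_mul, edist_dist] at h1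
  exact (ENNReal.ofReal_le_ofReal_iff (by linarith)).1 h1

theorem HasUnitSpeedOn.continuousOn_Icc {f : ℝ → X} {a b : ℝ} (hf : HasUnitSpeedOn f (Icc a b)) :
    ContinuousOn f (Icc a b) := by
  have : LipschitzOnWith 1 f (Icc a b) := by
    refine LipschitzOnWith.of_dist_le_mul fun s hs t ht => ?_
    rw [NNReal.coe_one, one_mul, Real.dist_eq]
    rcases le_total s t with h | h
    · rw [abs_sub_comm]
      exact (hf.dist_le hs.1 h ht.2).trans (le_abs_self _)
    · rw [dist_comm]
      exact (hf.dist_le ht.1 h hs.2).trans (le_abs_self _)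
  exact this.continuousOn

/-- The arc length function of a continuous curve of finite length is continuous. -/
theorem continuousOn_variationOnFromTo {f : ℝ → X} {a b : ℝ} (hab : a ≤ b)
    (hf : ContinuousOn f (Icc a b)) (hv : LocallyBoundedVariationOn f (Icc a b)) :
    ContinuousOn (variationOnFromTo f (Icc a b) a) (Icc a b) := by
  intro t ht
  have hl := variationOnFromTo.tendsto_left (left_mem_Icc.2 hab) ht hv
    ((hf t ht).mono_left (nhdsWithin_mono t inter_subset_left))
  have hr := variationOnFromTo.tendsto_right (left_mem_Icc.2 hab) ht hv
    ((hf t ht).mono_left (nhdsWithin_mono t inter_subset_left))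
  rw [dist_self, sub_zero] at hl
  rw [dist_self, add_zero] at hr
  have e : Icc a b = (Icc a b ∩ Iio t ∪ {t}) ∪ Icc a b ∩ Ioi t := by
    ext u
    simp only [mem_union, mem_inter_iff, mem_Iio, mem_Ioi, mem_singleton_iff]
    constructor
    · intro hu
      rcases lt_trichotomy u t with h | h | h <;> simp [h, hu]
    · rintro ((h | h) | h)
      exacts [h.1, h ▸ ht, h.1]
  unfold ContinuousWithinAt
  rw [e, nhdsWithin_union, nhdsWithin_union, tendsto_sup, tendsto_sup, nhdsWithin_singleton, ← e]
  exact ⟨⟨hl, tendsto_pure_nhds _ _⟩, hr⟩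

namespace RectCurve

/-- The arc length parametrization of a curve has unit speed on `[0, length γ]`. -/
theorem hasUnitSpeedOn_arcParam (γ : RectCurve X) :
    HasUnitSpeedOn γ.arcParam (Icc 0 γ.length.toReal) ∧ γ.arcParam 0 = γ.toFun γ.a ∧
      γ.arcParam γ.length.toReal = γ.toFun γ.b := by
  have hv : LocallyBoundedVariationOn γ.toFun (Icc γ.a γ.b) :=
    BoundedVariationOn.locallyBoundedVariationOn γ.rectifiable
  have ha := left_mem_Icc.2 γ.hab
  have hb := right_mem_Icc.2 γ.hab
  have h0 := variationOnFromTo.self γ.toFun (Icc γ.a γ.b) γ.a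
  have h1 : variationOnFromTo γ.toFun (Icc γ.a γ.b) γ.a γ.b = γ.length.toReal := by
    rw [variationOnFromTo.eq_of_le _ _ γ.hab, inter_self]; rfl
  have himg : variationOnFromTo γ.toFun (Icc γ.a γ.b) γ.a '' Icc γ.a γ.b
      = Icc 0 γ.length.toReal := by
    apply Subset.antisymm
    · rintro _ ⟨t, ht, rfl⟩
      exact ⟨h0 ▸ variationOnFromTo.monotoneOn hv ha ha ht ht.1,
        h1 ▸ variationOnFromTo.monotoneOn hv ha ht hb ht.2⟩
    · have := intermediate_value_Icc γ.hab
        (continuousOn_variationOnFromTo γ.hab γ.continuousOn hv)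
      rwa [h0, h1] at this
  refine ⟨himg ▸ has_unit_speed_naturalParameterization γ.toFun hv ha, ?_, ?_⟩
  · have := edist_naturalParameterization_eq_zero hv ha ha
    rw [h0] at this
    exact edist_eq_zero.1 this
  · have := edist_naturalParameterization_eq_zero hv ha hb
    rw [h1] at this
    exact edist_eq_zero.1 this

/-- A unit speed path on `[0, L]`, regarded as a curve. -/
def ofUnitSpeed (σ : ℝ → X) (L : ℝ) (hL : 0 ≤ L) (hσ : HasUnitSpeedOn σ (Icc 0 L)) :
    RectCurve X where
  a := 0
  b := L
  hab := hL
  toFun := σ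
  continuousOn := hσ.continuousOn_Icc
  rectifiable := by
    have := hσ (left_mem_Icc.2 hL) (right_mem_Icc.2 hL)
    rw [inter_self] at this
    rw [this]
    exact ENNReal.ofReal_ne_top

theorem length_ofUnitSpeed (σ : ℝ → X) (L : ℝ) (hL : 0 ≤ L) (hσ : HasUnitSpeedOn σ (Icc 0 L)) :
    (ofUnitSpeed σ L hL hσ).length = ENNReal.ofReal L := by
  have := hσ (left_mem_Icc.2 hL) (right_mem_Icc.2 hL)
  rw [inter_self, NNReal.coe_one, one_mul, sub_zero] at this
  exact this

theorem lineIntegral_ofUnitSpeed (σ : ℝ → X) (L : ℝ) (hL : 0 ≤ L)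
    (hσ : HasUnitSpeedOn σ (Icc 0 L)) (g : X → ℝ) :
    (ofUnitSpeed σ L hL hσ).lineIntegral g = ∫⁻ t in Icc 0 L, ENNReal.ofReal (g (σ t)) := by
  unfold lineIntegral
  rw [length_ofUnitSpeed, ENNReal.toReal_ofReal hL]
  refine setLIntegral_congr_fun measurableSet_Icc fun t ht => ?_
  have h := hasConstantSpeedOnWith_iff_variationOnFromTo_eq.1 hσ
  have h2 := edist_naturalParameterization_eq_zero h.1 (left_mem_Icc.2 hL) ht
  rw [h.2 (left_mem_Icc.2 hL) ht, NNReal.coe_one, one_mul, sub_zero] at h2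
  have h3 : (ofUnitSpeed σ L hL hσ).arcParam t = σ t := edist_eq_zero.1 h2
  simp only [h3]

end RectCurve

/-- The point `y` can be reached from `x` along a curve, parametrized by arc length, of length at
most `ℓ` along which the line integral of `g` is at most `c`. -/
def JoinedWithCost (g : X → ℝ) (x y : X) (ℓ : ℝ) (c : ℝ≥0∞) : Prop :=
  ∃ (σ : ℝ → X) (L : ℝ), 0 ≤ L ∧ L ≤ ℓ ∧ HasUnitSpeedOn σ (Icc 0 L) ∧ σ 0 = x ∧ σ L = y ∧
    ∫⁻ t in Icc 0 L, ENNReal.ofReal (g (σ t)) ≤ c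

theorem joinedWithCost_iff {g : X → ℝ} {x y : X} {ℓ : ℝ} (hℓ : 0 ≤ ℓ) {c : ℝ≥0∞} :
    JoinedWithCost g x y ℓ c ↔ ∃ γ : RectCurve X, γ.toFun γ.a = x ∧ γ.toFun γ.b = y ∧
      γ.length ≤ ENNReal.ofReal ℓ ∧ γ.lineIntegral g ≤ c := by
  constructor
  · rintro ⟨σ, L, hL, hLℓ, hσ, h0, h1, hc⟩
    refine ⟨RectCurve.ofUnitSpeed σ L hL hσ, h0, h1, ?_, ?_⟩
    · rw [RectCurve.length_ofUnitSpeed]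
      exact ENNReal.ofReal_le_ofReal hLℓ
    · rwa [RectCurve.lineIntegral_ofUnitSpeed]
  · rintro ⟨γ, h0, h1, hℓ', hc⟩
    obtain ⟨hu, ha, hb⟩ := γ.hasUnitSpeedOn_arcParam
    exact ⟨γ.arcParam, γ.length.toReal, ENNReal.toReal_nonneg,
      ENNReal.toReal_le_of_le_ofReal hℓ hℓ', hu, ha.trans h0, hb.trans h1, hc⟩

theorem JoinedWithCost.mono {g : X → ℝ} {x y : X} {ℓ ℓ' : ℝ} {c c' : ℝ≥0∞}
    (h : JoinedWithCost g x y ℓ c) (hℓ : ℓ ≤ ℓ') (hc : c ≤ c') : JoinedWithCost g x y ℓ' c' := by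
  obtain ⟨σ, L, hL, hLℓ, hσ, h0, h1, hi⟩ := h
  exact ⟨σ, L, hL, hLℓ.trans hℓ, hσ, h0, h1, hi.trans hc⟩

theorem HasUnitSpeedOn.joinedWithCost {σ : ℝ → X} {L s t : ℝ} (hσ : HasUnitSpeedOn σ (Icc 0 L))
    (hs : 0 ≤ s) (hst : s ≤ t) (htL : t ≤ L) (g : X → ℝ) :
    JoinedWithCost g (σ s) (σ t) (t - s) (∫⁻ u in Icc s t, ENNReal.ofReal (g (σ u))) := by
  refine ⟨fun u => σ (u + s), t - s, by linarith, le_rfl, ?_, by simp, by simp, ?_⟩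
  · apply HasUnitSpeedOn.comp_add_const
    exact hσ.mono_Icc (by linarith) (by linarith)
  · rw [← (measurePreserving_add_right volume s).setLIntegral_comp_preimage_emb
      (measurableEmbedding_addRight s) (fun u => ENNReal.ofReal (g (σ u)))]
    simp

theorem JoinedWithCost.trans {g : X → ℝ} {x y z : X} {ℓ ℓ' : ℝ} {c c' : ℝ≥0∞}
    (h : JoinedWithCost g x y ℓ c) (h' : JoinedWithCost g y z ℓ' c') :
    JoinedWithCost g x z (ℓ + ℓ') (c + c') := by
  obtain ⟨σ, L, hL, hLℓ, hσ, h0, h1, hi⟩ := h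
  obtain ⟨σ', L', hL', hLℓ', hσ', h0', h1', hi'⟩ := h'
  set τ : ℝ → X := fun t => if t ≤ L then σ t else σ' (t - L) with hτ
  have e1 : EqOn σ τ (Icc 0 L) := fun t ht => by simp [hτ, ht.2]
  have e2 : EqOn (fun t => σ' (t + -L)) τ (Icc L (L + L')) := fun t ht => by
    rcases ht.1.eq_or_lt with h | h
    · subst h; simp [hτ, h0', h1]
    · simp [hτ, not_le.2 h, sub_eq_add_neg]
  have u1 := hσ.congr e1
  have u2 : HasUnitSpeedOn τ (Icc L (L + L')) := by
    refine HasUnitSpeedOn.congr (HasUnitSpeedOn.comp_add_const (-L) ?_) e2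
    simpa using hσ'
  refine ⟨τ, L + L', by linarith, by linarith, u1.Icc_Icc u2, ?_, ?_, ?_⟩
  · rw [← e1 ⟨le_rfl, hL⟩, h0]
  · rw [← e2 ⟨by linarith, le_rfl⟩]; simp [h1']
  · rw [← Icc_union_Icc_eq_Icc hL (by linarith : L ≤ L + L')]
    refine (lintegral_union_le _ _ _).trans (add_le_add ?_ ?_)
    · refine le_trans (le_of_eq ?_) hi
      exact setLIntegral_congr_fun measurableSet_Icc fun t ht => by simp only [e1 ht]
    · refine le_trans (le_of_eq ?_) hi'
      rw [← (measurePreserving_add_right volume (-L)).setLIntegral_comp_preimage_emb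
        (measurableEmbedding_addRight (-L)) (fun u => ENNReal.ofReal (g (σ' u)))]
      have : (fun t => t + -L) ⁻¹' Icc 0 L' = Icc L (L + L') := by
        ext t; simp only [mem_preimage, mem_Icc]
        constructor <;> rintro ⟨h1, h2⟩ <;> constructor <;> linarith
      rw [this]
      exact setLIntegral_congr_fun measurableSet_Icc fun t ht => by simp only [← e2 ht]

end Curves

/-! ### Bridging gaps along a path -/

section Gaps

/-- The left end point of the component of `t` in the complement of the closed set `F`. -/
noncomputable def gapLeft (F : Set ℝ) (t : ℝ) : ℝ := sSup (F ∩ Iic t)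

/-- The right end point of the component of `t` in the complement of the closed set `F`. -/
noncomputable def gapRight (F : Set ℝ) (t : ℝ) : ℝ := sInf (F ∩ Ici t)

variable {F : Set ℝ} {a b t : ℝ}

theorem gapLeft_mem (hF : IsClosed F) (ha : a ∈ F) (hat : a ≤ t) : gapLeft F t ∈ F ∩ Iic t :=
  (hF.inter isClosed_Iic).csSup_mem ⟨a, ha, hat⟩ ⟨t, fun _ h => h.2⟩

theorem gapRight_mem (hF : IsClosed F) (hb : b ∈ F) (htb : t ≤ b) : gapRight F t ∈ F ∩ Ici t :=
  (hF.inter isClosed_Ici).csInf_mem ⟨b, hb, htb⟩ ⟨t, fun _ h => h.2⟩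

theorem le_gapLeft (ha : a ∈ F) (hat : a ≤ t) : a ≤ gapLeft F t :=
  le_csSup ⟨t, fun _ h => h.2⟩ ⟨ha, hat⟩

theorem gapRight_le (hb : b ∈ F) (htb : t ≤ b) : gapRight F t ≤ b :=
  csInf_le ⟨t, fun _ h => h.2⟩ ⟨hb, htb⟩

theorem gapLeft_lt (hF : IsClosed F) (ha : a ∈ F) (hat : a ≤ t) (ht : t ∉ F) : gapLeft F t < t :=
  have h := gapLeft_mem hF ha hat
  lt_of_le_of_ne h.2 fun e => ht (e ▸ h.1)

theorem lt_gapRight (hF : IsClosed F) (hb : b ∈ F) (htb : t ≤ b) (ht : t ∉ F) : t < gapRight F t :=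
  have h := gapRight_mem hF hb htb
  lt_of_le_of_ne h.2 fun e => ht (e ▸ h.1)

theorem notMem_of_mem_gap {u : ℝ} (hu : u ∈ Ioo (gapLeft F t) (gapRight F t)) : u ∉ F := by
  intro h
  rcases le_total u t with h' | h'
  · exact absurd (le_gapLeft h h') (not_le.2 hu.1)
  · exact absurd (gapRight_le h h') (not_le.2 hu.2)

variable {X : Type*} [MetricSpace X] {σ : ℝ → X} {L : ℝ} {g : X → ℝ} {Λ : ℝ≥0∞} {ν : ℝ}

open Classical in
/-- The integrand along the path `σ` after the gaps of `F` around the points of `T` have been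
bridged by curves with cost density `Λ`. -/
noncomputable def filledCost (g : X → ℝ) (σ : ℝ → X) (F : Set ℝ) (T : Finset ℝ) (Λ : ℝ≥0∞)
    (u : ℝ) : ℝ≥0∞ :=
  if ∃ t ∈ T, u ∈ Ioo (gapLeft F t) (gapRight F t) then Λ else ENNReal.ofReal (g (σ u))

/-- Bridging finitely many gaps: up to a time `s ∈ F`, each gap around a point of `T` is replaced by
the curve that is given across it. The proof removes the last gap before `s`. -/
theorem joinedWithCost_filledCost (hσ : HasUnitSpeedOn σ (Icc 0 L)) (hF : IsClosed F)
    (hFL : F ⊆ Icc 0 L) (h0 : 0 ∈ F) (hL : L ∈ F) (hν : 1 ≤ ν) {T : Finset ℝ}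
    (hT : ∀ t ∈ T, t ∈ Icc 0 L \ F) {s : ℝ} (hs : s ∈ F)
    (hgap : ∀ t ∈ T, t < s → JoinedWithCost g (σ (gapLeft F t)) (σ (gapRight F t))
      (ν * (gapRight F t - gapLeft F t))
      (Λ * ENNReal.ofReal (gapRight F t - gapLeft F t))) :
    JoinedWithCost g (σ 0) (σ s) (ν * s) (∫⁻ u in Icc 0 s, filledCost g σ F T Λ u) := by
  induction hn : (T.filter (· < s)).card using Nat.strong_induction_on generalizing s with
  | _ n ih =>
  have after : ∀ t ∈ T, s ≤ t → s ≤ gapLeft F t := fun t _ h => le_gapLeft hs h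
  rcases (T.filter (· < s)).eq_empty_or_nonempty with he | hne
  · have hG : ∀ u ∈ Icc 0 s, filledCost g σ F T Λ u = ENNReal.ofReal (g (σ u)) := by
      intro u hu
      refine if_neg ?_
      rintro ⟨t, ht, hut⟩
      have hst : s ≤ t := by
        by_contra h
        have : t ∈ T.filter (· < s) := Finset.mem_filter.2 ⟨ht, not_le.1 h⟩
        simp [he] at this
      linarith [after t ht hst, hut.1, hu.2]
    rw [setLIntegral_congr_fun measurableSet_Icc hG]
    have := hσ.joinedWithCost le_rfl (hFL hs).1 (hFL hs).2 g
    exact this.mono (by nlinarith [(hFL hs).1]) le_rfl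
  · set t := (T.filter (· < s)).max' hne with ht
    obtain ⟨htT, hts⟩ := Finset.mem_filter.1 (Finset.max'_mem _ hne)
    rw [← ht] at htT hts
    obtain ⟨htL, htF⟩ := hT t htT
    have hl := gapLeft_mem hF h0 htL.1
    have hr := gapRight_mem hF hL htL.2
    have hlt := gapLeft_lt hF h0 htL.1 htF
    have htr := lt_gapRight hF hL htL.2 htF
    have hrs : gapRight F t ≤ s := gapRight_le hs hts.le
    set l := gapLeft F t with hl_def
    set r := gapRight F t with hr_def
    have hcard : (T.filter (· < l)).card < n := by
      rw [← hn]
      refine Finset.card_lt_card ⟨fun v hv => ?_, fun h => ?_⟩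
      · rw [Finset.mem_filter] at hv ⊢
        exact ⟨hv.1, by linarith [hv.2]⟩
      · have := (Finset.mem_filter.1 (h (Finset.mem_filter.2 ⟨htT, hts⟩))).2
        linarith
    have j1 := ih _ hcard hl.1 (fun v hv hvl => hgap v hv (by linarith)) rfl
    have j2 := hgap t htT hts
    have j3 := hσ.joinedWithCost (hFL hr.1).1 hrs (hFL hs).2 g
    refine ((j1.trans j2).trans j3).mono (by nlinarith) ?_
    have e1 : ∫⁻ u in Ioo l r, filledCost g σ F T Λ u = Λ * ENNReal.ofReal (r - l) := by
      have : EqOn (filledCost g σ F T Λ) (fun _ => Λ) (Ioo l r) :=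
        fun u hu => if_pos ⟨t, htT, hu⟩
      rw [setLIntegral_congr_fun measurableSet_Ioo this]
      simp
    have e2 : ∫⁻ u in Icc r s, filledCost g σ F T Λ u
        = ∫⁻ u in Icc r s, ENNReal.ofReal (g (σ u)) := by
      refine setLIntegral_congr_fun measurableSet_Icc fun u hu => if_neg ?_
      rintro ⟨v, hv, huv⟩
      rcases lt_or_ge v s with h | h
      · have hvt : v ≤ t := Finset.le_max' _ _ (Finset.mem_filter.2 ⟨hv, h⟩)
        have : gapRight F v ≤ r := gapRight_le hr.1 (hvt.trans htr.le)
        linarith [huv.2, hu.1]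
      · linarith [after v hv h, huv.1, hu.2]
    rw [← e1, ← e2]
    have hd : Icc 0 s = (Icc 0 l ∪ Ioo l r) ∪ Icc r s := by
      rw [Icc_union_Ioo_eq_Ico (hFL hl.1).1 (hlt.trans htr),
        Ico_union_Icc_eq_Icc (by linarith [(hFL hl.1).1]) hrs]
    rw [hd, lintegral_union measurableSet_Icc, lintegral_union measurableSet_Ioo]
    · exact disjoint_left.2 fun u h1 h2 => absurd h1.2 (not_le.2 h2.1)
    · rw [disjoint_left]
      rintro u (h | h) h2
      · linarith [h.2, h2.1]
      · linarith [h.2, h2.1]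

/-- Finitely many gaps of a closed set exhaust its complement in `[0, L]` up to small measure. -/
theorem exists_finset_gaps (hF : IsClosed F) (h0 : 0 ∈ F) (hL : L ∈ F) {ε : ℝ≥0∞} (hε : ε ≠ 0) :
    ∃ T : Finset ℝ, (∀ t ∈ T, t ∈ Icc 0 L \ F) ∧
      volume {u ∈ Icc 0 L \ F | ¬ ∃ t ∈ T, u ∈ Ioo (gapLeft F t) (gapRight F t)} ≤ ε := by
  have hfin : volume (Icc 0 L \ F) ≠ ∞ :=
    ne_top_of_le_ne_top (by simp) (measure_mono (sdiff_subset (s := Icc 0 L) (t := F)))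
  obtain ⟨C, hCU, hC, hCε⟩ :=
    (measurableSet_Icc.diff hF.measurableSet).exists_isCompact_sdiff_lt hfin hε
  obtain ⟨T, hTC, hT⟩ := hC.elim_nhds_subcover (fun t => Ioo (gapLeft F t) (gapRight F t))
    fun t ht => Ioo_mem_nhds (gapLeft_lt hF h0 (hCU ht).1.1 (hCU ht).2)
      (lt_gapRight hF hL (hCU ht).1.2 (hCU ht).2)
  refine ⟨T, fun t ht => hCU (hTC t ht), (measure_mono ?_).trans hCε.le⟩
  rintro u ⟨hu, hn⟩
  refine ⟨hu, fun huC => hn ?_⟩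
  obtain ⟨t, ht, hut⟩ := mem_iUnion₂.1 (hT huC)
  exact ⟨t, ht, hut⟩

/-- Surgery on a path: if `g ≤ Λ₀` along the path at the times in `F`, then one can follow the path,
bridging the gaps of `F` at cost `Λ` per unit length, until either the end is reached or a gap
`(s, r)` occurs that cannot be bridged. All but finitely many gaps, of total length at most `ε`, are
left as they are, which costs at most `ε` since `g ≤ 1`. -/
theorem exists_joinedWithCost_until (hσ : HasUnitSpeedOn σ (Icc 0 L)) (hF : IsClosed F)
    (hFL : F ⊆ Icc 0 L) (h0 : 0 ∈ F) (hL : L ∈ F) (hν : 1 ≤ ν) (hg1 : ∀ y, g y ≤ 1)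
    {Λ₀ : ℝ≥0∞} (hgF : ∀ u ∈ F, u < L → ENNReal.ofReal (g (σ u)) ≤ Λ₀)
    {ε : ℝ≥0∞} (hε : ε ≠ 0) :
    ∃ s ∈ F, JoinedWithCost g (σ 0) (σ s) (ν * s)
        (Λ₀ * ENNReal.ofReal L + Λ * volume (Icc 0 L \ F) + ε) ∧
      (s = L ∨ ∃ r ∈ F, s < r ∧ Ioo s r ⊆ Icc 0 L \ F ∧
        ¬ JoinedWithCost g (σ s) (σ r) (ν * (r - s)) (Λ * ENNReal.ofReal (r - s))) := by
  obtain ⟨T, hT, hTε⟩ := exists_finset_gaps hF h0 hL hε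
  have cost : ∀ s ∈ F, ∫⁻ u in Icc 0 s, filledCost g σ F T Λ u
      ≤ Λ₀ * ENNReal.ofReal L + Λ * volume (Icc 0 L \ F) + ε := by
    intro s hs
    set U := Icc 0 L \ F with hU
    have hUm : MeasurableSet U := measurableSet_Icc.diff hF.measurableSet
    set V := {u ∈ U | ¬ ∃ t ∈ T, u ∈ Ioo (gapLeft F t) (gapRight F t)} with hV
    have hVm : MeasurableSet V := by
      have : V = U \ ⋃ t ∈ T, Ioo (gapLeft F t) (gapRight F t) := by
        ext u
        simp only [hV, mem_ofPred_eq, mem_sdiff, mem_iUnion, exists_prop]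
      rw [this]
      exact hUm.diff (Finset.measurableSet_biUnion _ fun _ _ => measurableSet_Ioo)
    calc ∫⁻ u in Icc 0 s, filledCost g σ F T Λ u
        ≤ ∫⁻ u in Icc 0 L, filledCost g σ F T Λ u :=
          lintegral_mono_set (Icc_subset_Icc_right (hFL hs).2)
      _ = ∫⁻ u in Ico 0 L, filledCost g σ F T Λ u := setLIntegral_congr Ico_ae_eq_Icc.symm
      _ ≤ ∫⁻ u in Ico 0 L, (Λ₀ + U.indicator (fun _ => Λ) u + V.indicator (fun _ => 1) u) := by
          refine setLIntegral_mono' measurableSet_Ico fun u hu => ?_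
          by_cases huT : ∃ t ∈ T, u ∈ Ioo (gapLeft F t) (gapRight F t)
          · obtain ⟨t, ht, hut⟩ := huT
            have huU : u ∈ U := ⟨⟨hu.1, hu.2.le⟩, notMem_of_mem_gap hut⟩
            rw [filledCost, if_pos ⟨t, ht, hut⟩, indicator_of_mem huU]
            exact le_add_right (le_add_left le_rfl)
          · rw [filledCost, if_neg huT]
            by_cases huF : u ∈ F
            · exact le_add_right (le_add_right (hgF u huF hu.2))
            · have huV : u ∈ V := ⟨⟨⟨hu.1, hu.2.le⟩, huF⟩, huT⟩
              rw [indicator_of_mem huV]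
              exact le_add_left (ENNReal.ofReal_le_one.2 (hg1 _))
      _ ≤ _ := by
          rw [lintegral_add_right _ (measurable_const.indicator hVm),
            lintegral_add_right _ (measurable_const.indicator hUm)]
          refine add_le_add (add_le_add ?_ ?_) ?_
          · simp
          · refine (setLIntegral_le_lintegral _ _).trans ?_
            rw [lintegral_indicator_const hUm]
          · refine (setLIntegral_le_lintegral _ _).trans ?_
            rw [lintegral_indicator_const hVm, one_mul]
            exact hTε
  classical
  set B := T.filter fun t => ¬ JoinedWithCost g (σ (gapLeft F t)) (σ (gapRight F t))
      (ν * (gapRight F t - gapLeft F t)) (Λ * ENNReal.ofReal (gapRight F t - gapLeft F t)) with hB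
  rcases B.eq_empty_or_nonempty with he | hne
  · refine ⟨L, hL, (joinedWithCost_filledCost hσ hF hFL h0 hL hν hT hL ?_).mono le_rfl
      (cost L hL), Or.inl rfl⟩
    intro t ht _
    by_contra h
    have : t ∈ B := Finset.mem_filter.2 ⟨ht, h⟩
    simp [he] at this
  · set t := B.min' hne with ht
    obtain ⟨htT, htbad⟩ := Finset.mem_filter.1 (Finset.min'_mem _ hne)
    rw [← ht] at htT htbad
    obtain ⟨htL, htF⟩ := hT t htT
    have hl := gapLeft_mem hF h0 htL.1
    have hr := gapRight_mem hF hL htL.2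
    have hlt := gapLeft_lt hF h0 htL.1 htF
    have htr := lt_gapRight hF hL htL.2 htF
    refine ⟨gapLeft F t, hl.1, (joinedWithCost_filledCost hσ hF hFL h0 hL hν hT hl.1 ?_).mono le_rfl
      (cost _ hl.1), Or.inr ⟨gapRight F t, hr.1, hlt.trans htr, fun u hu => ?_, htbad⟩⟩
    · intro v hv hvl
      by_contra h
      have : t ≤ v := Finset.min'_le _ _ (Finset.mem_filter.2 ⟨hv, h⟩)
      linarith
    · exact ⟨⟨(hFL hl.1).1.trans hu.1.le, hu.2.le.trans (hFL hr.1).2⟩, notMem_of_mem_gap hu⟩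

end Gaps

/-! ### High sets and the weak type estimate -/

section WeakType

open Metric

variable {X : Type*} [MetricSpace X] [MeasurableSpace X]

/-- Doubling of the measure `W` for balls centred in `Ω` with radius at most `κ d(x, Ωᶜ)`. -/
structure IsDoublingIn (W : Measure X) (Ω : Set X) (κ : ℝ) (A : ℝ≥0∞) : Prop where
  one_le : 1 ≤ A
  lt_top : ∀ (x : X) (r : ℝ), W (ball x r) < ∞
  pos : ∀ x ∈ Ω, ∀ r : ℝ, 0 < r → r ≤ κ * infDist x Ωᶜ → 0 < W (ball x r)
  le_half : ∀ x ∈ Ω, ∀ r : ℝ, 0 < r → r ≤ κ * infDist x Ωᶜ →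
    W (ball x r) ≤ A * W (ball x (r / 2))

/-- The set of points `y` of `Ω` that lie well inside some ball `B(z, s)`, with
`s < min {K d(y, Ωᶜ), R}`, over which the average of `f` exceeds `c`. It is open, and it contains
all points at which the corresponding centred maximal function exceeds `c`. -/
def highSet (W : Measure X) (Ω : Set X) (f : X → ℝ≥0∞) (K R : ℝ) (c : ℝ≥0∞) : Set X :=
  {y ∈ Ω | ∃ z s, dist y z < s / 2 ∧ s < K * infDist y Ωᶜ ∧ s < R ∧
    c * W (ball z s) < ∫⁻ u in ball z s, f u ∂W}

variable {W : Measure X} {Ω : Set X} {κ K R : ℝ} {A c c₀ : ℝ≥0∞} {f : X → ℝ≥0∞} {x y : X}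

theorem isOpen_highSet (hΩ : IsOpen Ω) : IsOpen (highSet W Ω f K R c) := by
  have : highSet W Ω f K R c = ⋃ (z : X) (s : ℝ) (_ : s < R ∧
      c * W (ball z s) < ∫⁻ u in ball z s, f u ∂W),
      Ω ∩ ({y | dist y z < s / 2} ∩ {y | s < K * infDist y Ωᶜ}) := by
    ext y
    simp only [highSet, mem_ofPred_eq, mem_iUnion, mem_inter_iff, exists_prop]
    constructor
    · rintro ⟨h, z, s, h1, h2, h3, h4⟩
      exact ⟨z, s, ⟨h3, h4⟩, h, h1, h2⟩
    · rintro ⟨z, s, ⟨h3, h4⟩, h, h1, h2⟩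
      exact ⟨h, z, s, h1, h2, h3, h4⟩
  rw [this]
  refine isOpen_iUnion fun z => isOpen_iUnion fun s => isOpen_iUnion fun _ => hΩ.inter
    (IsOpen.inter ?_ ?_)
  · exact isOpen_lt (by fun_prop) continuous_const
  · exact isOpen_lt continuous_const (continuous_const.mul (continuous_infDist_pt _))

theorem setLIntegral_le_of_notMem_highSet (hy : y ∈ Ω) (hyE : y ∉ highSet W Ω f K R c) {s : ℝ}
    (hs : 0 < s) (hsK : s < K * infDist y Ωᶜ) (hsR : s < R) :
    ∫⁻ u in ball y s, f u ∂W ≤ c * W (ball y s) := by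
  by_contra h
  exact hyE ⟨hy, y, s, by rw [dist_self]; linarith, hsK, hsR, not_le.1 h⟩

theorem IsDoublingIn.le_pow (h : IsDoublingIn W Ω κ A) {x : X} (hx : x ∈ Ω) (n : ℕ) {r ρ : ℝ}
    (hr : 0 < r) (hrκ : 2 ^ n * r ≤ κ * infDist x Ωᶜ) (hρ : ρ ≤ 2 ^ n * r) :
    W (ball x ρ) ≤ A ^ n * W (ball x r) := by
  refine (measure_mono (ball_subset_ball hρ)).trans ?_
  clear hρ
  induction n with
  | zero => simp
  | succ n ih =>
    have h2 := h.le_half x hx (2 ^ (n + 1) * r) (by positivity) hrκ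
    have e : 2 ^ (n + 1) * r / 2 = 2 ^ n * r := by ring
    rw [e] at h2
    have hle : 2 ^ n * r ≤ κ * infDist x Ωᶜ := by
      refine le_trans ?_ hrκ
      have : 0 < (2 : ℝ) ^ n * r := by positivity
      rw [pow_succ]; linarith
    calc _ ≤ A * W (ball x (2 ^ n * r)) := h2
      _ ≤ A * (A ^ n * W (ball x r)) := by gcongr; exact ih hle
      _ = A ^ (n + 1) * W (ball x r) := by rw [pow_succ]; ring

/-- Witnesses for `y` in the high set have radius less than `d(x, y)` when the averages of `f` over
all balls centred at `x` are much smaller than `c`. -/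
theorem radius_lt_dist (h : IsDoublingIn W Ω (16 * K) A)
    (hRK : 3 * R ≤ K * infDist x Ωᶜ)
    (hx : ∀ ρ, 0 < ρ → ρ < K * infDist x Ωᶜ → ∫⁻ u in ball x ρ, f u ∂W ≤ c₀ * W (ball x ρ))
    (hc : A ^ 3 * c₀ ≤ c) (hy : y ∈ Ω) {z : X} {s : ℝ} (hyz : dist y z < s / 2)
    (hsK : s < K * infDist y Ωᶜ) (hsR : s < R)
    (hzs : c * W (ball z s) < ∫⁻ u in ball z s, f u ∂W) : s < dist x y := by
  by_contra hxy
  rw [not_lt] at hxy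
  have hs : 0 < s := by linarith [dist_nonneg (x := y) (y := z)]
  refine absurd hzs (not_lt.2 ?_)
  calc ∫⁻ u in ball z s, f u ∂W ≤ ∫⁻ u in ball x (3 * s), f u ∂W := by
        refine lintegral_mono_set (ball_subset_ball' ?_)
        have := dist_triangle z y x
        rw [dist_comm z y, dist_comm y x] at this
        linarith
    _ ≤ c₀ * W (ball x (3 * s)) := hx _ (by linarith) (by linarith)
    _ ≤ c₀ * W (ball y (4 * s)) := by
        gcongr
        exact ball_subset_ball' (by linarith)
    _ ≤ c₀ * (A ^ 3 * W (ball y (s / 2))) := by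
        gcongr
        exact h.le_pow hy 3 (by linarith) (by linarith) (by linarith)
    _ ≤ c₀ * (A ^ 3 * W (ball z s)) := by
        gcongr
        exact ball_subset_ball' (by linarith)
    _ = A ^ 3 * c₀ * W (ball z s) := by ring
    _ ≤ c * W (ball z s) := by gcongr

theorem notMem_highSet_self (h : IsDoublingIn W Ω (16 * K) A)
    (hRK : 3 * R ≤ K * infDist x Ωᶜ)
    (hx : ∀ ρ, 0 < ρ → ρ < K * infDist x Ωᶜ → ∫⁻ u in ball x ρ, f u ∂W ≤ c₀ * W (ball x ρ))
    (hc : A ^ 3 * c₀ ≤ c) : x ∉ highSet W Ω f K R c := by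
  rintro ⟨hxΩ, z, s, h1, h2, h3, h4⟩
  have := radius_lt_dist h hRK hx hc hxΩ h1 h2 h3 h4
  rw [dist_self] at this
  linarith [dist_nonneg (x := x) (y := z)]

/-- The weak type estimate for the high set, localized to balls centred at a point `x` where the
averages of `f` are controlled. It follows from the Vitali covering theorem. -/
theorem measure_highSet_inter_ball_le [BorelSpace X] (h : IsDoublingIn W Ω (16 * K) A)
    (hxΩ : x ∈ Ω) (hRK : 3 * R ≤ K * infDist x Ωᶜ)
    (hx : ∀ ρ, 0 < ρ → ρ < K * infDist x Ωᶜ → ∫⁻ u in ball x ρ, f u ∂W ≤ c₀ * W (ball x ρ))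
    (hc : A ^ 3 * c₀ ≤ c) {r : ℝ} (hr : 0 < r) (hrR : r < R) :
    c * W (highSet W Ω f K R c ∩ ball x r) ≤ A ^ 7 * c₀ * W (ball x r) := by
  set t := highSet W Ω f K R c ∩ ball x r with ht
  have hex : ∀ y : X, ∃ (z : X) (s : ℝ), y ∈ t → dist y z < s / 2 ∧ s < K * infDist y Ωᶜ ∧ s < r ∧
      c * W (ball z s) < ∫⁻ u in ball z s, f u ∂W := by
    intro y
    by_cases hy : y ∈ t
    · obtain ⟨⟨hyΩ, z, s, h1, h2, h3, h4⟩, hyx⟩ := hy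
      have := radius_lt_dist h hRK hx hc hyΩ h1 h2 h3 h4
      rw [mem_ball, dist_comm] at hyx
      exact ⟨z, s, fun _ => ⟨h1, h2, by linarith, h4⟩⟩
    · exact ⟨y, 0, fun h => absurd h hy⟩
  choose z s hzs using hex
  have hspos : ∀ y ∈ t, 0 < s y := fun y hy => by
    linarith [(hzs y hy).1, dist_nonneg (x := y) (y := z y)]
  obtain ⟨u, hut, hdisj, hcov⟩ := Vitali.exists_disjoint_subfamily_covering_enlargement_closedBall
    t (fun y => y) (fun y => 2 * s y) (2 * r) (fun y hy => by linarith [(hzs y hy).2.2.1]) 5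
    (by norm_num)
  have hsub : ∀ y ∈ t, ball (z y) (s y) ⊆ closedBall y (2 * s y) := fun y hy =>
    ball_subset_closedBall.trans (closedBall_subset_closedBall'
      (by rw [dist_comm]; linarith [(hzs y hy).1, hspos y hy]))
  have hsubx : ∀ y ∈ t, ball (z y) (s y) ⊆ ball x (3 * r) := fun y hy => by
    refine ball_subset_ball' ?_
    have h1 := dist_triangle (z y) y x
    have h2 : dist y x < r := hy.2
    rw [dist_comm (z y) y] at h1
    linarith [(hzs y hy).1, (hzs y hy).2.2.1]
  have hdisj' : Pairwise (Function.onFun Disjoint fun b : u => ball (z b) (s b)) := by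
    intro a b hab
    exact (hdisj a.2 b.2 fun e => hab (Subtype.ext e)).mono (hsub _ (hut a.2)) (hsub _ (hut b.2))
  have hgrow : ∀ y ∈ t, W (closedBall y (5 * (2 * s y))) ≤ A ^ 5 * W (ball (z y) (s y)) := by
    intro y hy
    have hs := hspos y hy
    calc W (closedBall y (5 * (2 * s y))) ≤ W (ball y (16 * s y)) :=
          measure_mono (closedBall_subset_ball (by linarith))
      _ ≤ A ^ 5 * W (ball y (s y / 2)) :=
          h.le_pow hy.1.1 5 (by linarith) (by linarith [(hzs y hy).2.1]) (by linarith)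
      _ ≤ A ^ 5 * W (ball (z y) (s y)) := by
          gcongr
          exact ball_subset_ball' (by linarith [(hzs y hy).1])
  have hcount : Countable u := by
    have hc := Measure.countable_meas_pos_of_disjoint_of_meas_iUnion_ne_top W
      (As := fun b : u => ball (z b) (s b)) (fun _ => measurableSet_ball) hdisj'
      (ne_top_of_le_ne_top (h.lt_top x (3 * r)).ne
        (measure_mono (iUnion_subset fun b => hsubx _ (hut b.2))))
    have : {b : u | 0 < W (ball (z b) (s b))} = univ := by
      refine eq_univ_of_forall fun b => ?_
      have hb := hut b.2
      have hs := hspos _ hb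
      refine (h.pos b hb.1.1 (s b / 2) (by linarith) ?_).trans_le
        (measure_mono (ball_subset_ball' (by linarith [(hzs _ hb).1])))
      linarith [(hzs _ hb).2.1]
    rw [this] at hc
    exact countable_univ_iff.1 hc
  calc c * W t ≤ c * W (⋃ b : u, closedBall (b : X) (5 * (2 * s b))) := by
        gcongr
        intro y hy
        obtain ⟨b, hb, hyb⟩ := hcov y hy
        exact mem_iUnion.2 ⟨⟨b, hb⟩, hyb (mem_closedBall_self (by linarith [hspos y hy]))⟩
    _ ≤ c * ∑' b : u, W (closedBall (b : X) (5 * (2 * s b))) := by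
        gcongr
        exact measure_iUnion_le _
    _ ≤ c * ∑' b : u, A ^ 5 * W (ball (z b) (s b)) := by
        gcongr with b
        exact hgrow b (hut b.2)
    _ = A ^ 5 * ∑' b : u, c * W (ball (z b) (s b)) := by
        rw [ENNReal.tsum_mul_left, ENNReal.tsum_mul_left]; ring
    _ ≤ A ^ 5 * ∑' b : u, ∫⁻ v in ball (z b) (s b), f v ∂W := by
        gcongr with b
        exact (hzs _ (hut b.2)).2.2.2.le
    _ = A ^ 5 * ∫⁻ v in ⋃ b : u, ball (z b) (s b), f v ∂W := by
        rw [lintegral_iUnion (fun _ => measurableSet_ball) hdisj']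
    _ ≤ A ^ 5 * ∫⁻ v in ball x (3 * r), f v ∂W := by
        gcongr
        exact iUnion_subset fun b => hsubx _ (hut b.2)
    _ ≤ A ^ 5 * (c₀ * W (ball x (3 * r))) := by
        gcongr
        exact hx _ (by linarith) (by linarith)
    _ ≤ A ^ 5 * (c₀ * (A ^ 2 * W (ball x r))) := by
        gcongr
        have : 0 ≤ infDist x Ωᶜ := infDist_nonneg
        exact h.le_pow hxΩ 2 hr (by linarith) (by linarith)
    _ = A ^ 7 * c₀ * W (ball x r) := by ring

end WeakType

/-! ### Averages with respect to the weight -/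

section Averages

open Metric

theorem weightOf_eq_withDensity {X : Type*} [MeasurableSpace X] {μ : Measure X}
    {w : X → ℝ≥0∞} {s : Set X}
    (hs : MeasurableSet s) : weightOf μ w s = μ.withDensity w s :=
  (withDensity_apply w hs).symm

variable {X : Type*} [MetricSpace X] [MeasurableSpace X]

theorem weightedAverage_le_iff [OpensMeasurableSpace X] {μ : Measure X} {w : X → ℝ≥0∞}
    (hw : Measurable w) {g : X → ℝ} (hg : Measurable g) {p : ℝ} (hp : 0 < p) {x : X} {r : ℝ}
    (h0 : μ.withDensity w (ball x r) ≠ 0) (h1 : μ.withDensity w (ball x r) ≠ ∞) {c : ℝ≥0∞} :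
    weightedAverage μ w p g x r ≤ c ↔
      ∫⁻ y in ball x r, ‖g y‖ₑ ^ p ∂(μ.withDensity w) ≤ c ^ p * μ.withDensity w (ball x r) := by
  rw [weightedAverage, weightOf_eq_withDensity measurableSet_ball,
    setLIntegral_withDensity_eq_setLIntegral_mul μ hw (hg.enorm.pow_const p) measurableSet_ball,
    one_div, ENNReal.rpow_inv_le_iff hp, ENNReal.div_le_iff h0 h1]
  simp only [Pi.mul_apply, mul_comm]

theorem IsSemilocallyDoubling.isDoublingIn [OpensMeasurableSpace X] {μ : Measure X} {Ω : Set X}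
    {w : X → ℝ≥0∞} (hw : IsSemilocallyDoubling μ Ω w) {κ : ℝ} (hκ : 0 < κ) :
    ∃ D : ℝ, 1 ≤ D ∧ IsDoublingIn (μ.withDensity w) Ω κ (ENNReal.ofReal D) := by
  obtain ⟨D, hD, h⟩ := hw.doubling κ hκ
  refine ⟨D, hD, ENNReal.one_le_ofReal.2 hD, fun x r => ?_, fun x hx r hr hrκ => ?_,
    fun x hx r hr hrκ => ?_⟩
  · rcases le_or_gt r 0 with hr | hr
    · simp [ball_eq_empty.2 hr]
    · rw [← weightOf_eq_withDensity measurableSet_ball]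
      exact hw.isWeight.ball_lt_top x r hr
  · rw [← weightOf_eq_withDensity measurableSet_ball]
    exact (h x hx r hr hrκ).1
  · rw [← weightOf_eq_withDensity measurableSet_ball, ← weightOf_eq_withDensity measurableSet_ball]
    exact (h x hx r hr hrκ).2.1

/-- An elementary substitute for Hölder's inequality between averages, at the cost of a factor `2`.
It rests on `t ^ p ≤ t ^ q + 1`. -/
theorem setLIntegral_rpow_le_of_le {X : Type*} [MeasurableSpace X]
    {W : Measure X} {B : Set X} {f : X → ℝ≥0∞} (hf : Measurable f) (hft : ∀ y, f y ≠ ∞)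
    {p q : ℝ} (hp : 1 ≤ p) (hpq : p ≤ q)
    {c : ℝ≥0∞} (hc0 : c ≠ 0) (hct : c ≠ ∞) (h : ∫⁻ y in B, f y ^ q ∂W ≤ c ^ q * W B) :
    ∫⁻ y in B, f y ^ p ∂W ≤ (2 * c) ^ p * W B := by
  have hpt : ∀ t : ℝ≥0∞, t ≠ ∞ → t ^ p ≤ c ^ (p - q) * t ^ q + c ^ p := by
    intro t ht
    rcases le_total t c with htc | htc
    · exact le_add_left (ENNReal.rpow_le_rpow htc (by linarith))
    · have ht0 : t ≠ 0 := fun e => hc0 (le_antisymm (e ▸ htc) zero_le)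
      refine le_add_right ?_
      calc t ^ p = t ^ (p - q) * t ^ q := by
            rw [← ENNReal.rpow_add _ _ ht0 ht]; congr 1; ring
        _ ≤ c ^ (p - q) * t ^ q := by
            gcongr ?_ * _
            rw [← neg_sub q p, ENNReal.rpow_neg, ENNReal.rpow_neg, ENNReal.inv_le_inv]
            exact ENNReal.rpow_le_rpow htc (by linarith)
  calc ∫⁻ y in B, f y ^ p ∂W ≤ ∫⁻ y in B, (c ^ (p - q) * f y ^ q + c ^ p) ∂W :=
        lintegral_mono fun y => hpt _ (hft y)
    _ = c ^ (p - q) * ∫⁻ y in B, f y ^ q ∂W + c ^ p * W B := by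
        rw [lintegral_add_right _ measurable_const, lintegral_const_mul _ (hf.pow_const q)]
        simp
    _ ≤ c ^ (p - q) * (c ^ q * W B) + c ^ p * W B := by gcongr
    _ = 2 * c ^ p * W B := by
        rw [← mul_assoc, ← ENNReal.rpow_add _ _ hc0 hct]
        rw [show p - q + q = p by ring]; ring
    _ ≤ (2 * c) ^ p * W B := by
        rw [ENNReal.mul_rpow_of_nonneg _ _ (by linarith)]
        gcongr
        calc (2 : ℝ≥0∞) = 2 ^ (1 : ℝ) := by simp
          _ ≤ 2 ^ p := ENNReal.rpow_le_rpow_of_exponent_le (by norm_num) hp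

/-- A lower semicontinuous function is dominated by the bounds on its averages over small balls. -/
theorem LowerSemicontinuous.le_of_setLIntegral_le [OpensMeasurableSpace X] {W : Measure X}
    {g : X → ℝ} (hg : LowerSemicontinuous g) {y : X} {c q ρ : ℝ} (hc : 0 ≤ c) (hq : 0 < q)
    (hρ : 0 < ρ) (hpos : ∀ s, 0 < s → s < ρ → 0 < W (ball y s))
    (hfin : ∀ s, W (ball y s) < ∞)
    (h : ∀ s, 0 < s → s < ρ →
      ∫⁻ u in ball y s, ‖g u‖ₑ ^ q ∂W ≤ ENNReal.ofReal c ^ q * W (ball y s)) : g y ≤ c := by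
  by_contra hgy
  rw [not_le] at hgy
  obtain ⟨b, hcb, hbg⟩ := exists_between hgy
  obtain ⟨s, hs, hsb⟩ := Metric.eventually_nhds_iff_ball.1 (hg y b hbg)
  set t := min s (ρ / 2) with ht
  have ht0 : 0 < t := lt_min hs (by linarith)
  have htρ : t < ρ := (min_le_right _ _).trans_lt (by linarith)
  have h1 : ENNReal.ofReal b ^ q * W (ball y t) ≤ ENNReal.ofReal c ^ q * W (ball y t) := by
    refine le_trans ?_ (h t ht0 htρ)
    rw [← setLIntegral_const]
    refine setLIntegral_mono' measurableSet_ball fun u hu => ?_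
    gcongr
    rw [Real.enorm_eq_ofReal_abs]
    exact ENNReal.ofReal_le_ofReal
      ((hsb u (ball_subset_ball (min_le_left _ _) hu)).le.trans (le_abs_self _))
  rw [ENNReal.mul_le_mul_iff_left (hpos t ht0 htρ).ne' (hfin t).ne,
    ENNReal.rpow_le_rpow_iff hq, ENNReal.ofReal_le_ofReal_iff hc] at h1
  linarith

/-- For a lacunary sum the `p`-th power of the sum is comparable to the sum of the `p`-th powers. -/
theorem sum_pow_rpow_le {M p : ℝ} (hM : 2 ≤ M) (hp : 0 < p) (S : Finset ℕ) :
    (∑ i ∈ S, M ^ i) ^ p ≤ 2 ^ p * ∑ i ∈ S, (M ^ i) ^ p := by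
  rcases S.eq_empty_or_nonempty with rfl | hS
  · simp [Real.zero_rpow hp.ne']
  have hM0 : 0 < M := by linarith
  set m := S.max' hS
  have hgeom : ∀ n : ℕ, ∑ i ∈ Finset.range (n + 1), M ^ i ≤ 2 * M ^ n := by
    intro n
    induction n with
    | zero => simp
    | succ n ih =>
      rw [Finset.sum_range_succ, pow_succ M n]
      nlinarith [pow_pos hM0 n]
  have h1 : ∑ i ∈ S, M ^ i ≤ 2 * M ^ m :=
    (Finset.sum_le_sum_of_subset_of_nonneg
      (fun i hi => Finset.mem_range_succ_iff.2 (Finset.le_max' _ _ hi))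
      fun i _ _ => (pow_pos hM0 i).le).trans (hgeom m)
  calc (∑ i ∈ S, M ^ i) ^ p ≤ (2 * M ^ m) ^ p :=
        Real.rpow_le_rpow (Finset.sum_nonneg fun i _ => (pow_pos hM0 i).le) h1 hp.le
    _ = 2 ^ p * (M ^ m) ^ p := Real.mul_rpow (by norm_num) (pow_pos hM0 m).le
    _ ≤ 2 ^ p * ∑ i ∈ S, (M ^ i) ^ p := by
        gcongr
        exact Finset.single_le_sum (f := fun i => (M ^ i) ^ p)
          (fun i _ => Real.rpow_nonneg (pow_pos hM0 i).le p) (Finset.max'_mem _ _)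

theorem setLIntegral_sum_indicator_rpow_le {X : Type*} [MeasurableSpace X] {W : Measure X}
    {B : Set X}
    {E : ℕ → Set X} (hE : ∀ i, MeasurableSet (E i)) {M p : ℝ} (hM : 2 ≤ M) (hp : 0 < p)
    (S : Finset ℕ) :
    ∫⁻ y in B, ‖∑ i ∈ S, (E i).indicator (fun _ => M ^ i) y‖ₑ ^ p ∂W
      ≤ 2 ^ p * ∑ i ∈ S, ENNReal.ofReal (M ^ i) ^ p * W (E i ∩ B) := by
  classical
  have hM0 : 0 < M := by linarith
  have hpt : ∀ y, ‖∑ i ∈ S, (E i).indicator (fun _ => M ^ i) y‖ₑ ^ p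
      ≤ 2 ^ p * ∑ i ∈ S, (E i).indicator (fun _ => ENNReal.ofReal (M ^ i) ^ p) y := by
    intro y
    have e1 : ∑ i ∈ S, (E i).indicator (fun _ => M ^ i) y
        = ∑ i ∈ S.filter (fun i => y ∈ E i), M ^ i := by
      rw [Finset.sum_filter]; rfl
    have e2 : ∑ i ∈ S, (E i).indicator (fun _ => ENNReal.ofReal (M ^ i) ^ p) y
        = ∑ i ∈ S.filter (fun i => y ∈ E i), ENNReal.ofReal ((M ^ i) ^ p) := by
      rw [Finset.sum_filter]
      refine Finset.sum_congr rfl fun i _ => ?_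
      rw [ENNReal.ofReal_rpow_of_pos (pow_pos hM0 i)]; rfl
    have h2 : (2 : ℝ≥0∞) ^ p = ENNReal.ofReal (2 ^ p) := by
      rw [← ENNReal.ofReal_rpow_of_pos two_pos]; simp
    have h0 : 0 ≤ ∑ i ∈ S.filter (fun i => y ∈ E i), M ^ i :=
      Finset.sum_nonneg fun i _ => (pow_pos hM0 i).le
    rw [e1, e2, Real.enorm_of_nonneg h0, ENNReal.ofReal_rpow_of_nonneg h0 hp.le,
      ← ENNReal.ofReal_sum_of_nonneg fun i _ => Real.rpow_nonneg (pow_pos hM0 i).le p, h2,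
      ← ENNReal.ofReal_mul (by positivity)]
    exact ENNReal.ofReal_le_ofReal (sum_pow_rpow_le hM hp _)
  refine (lintegral_mono hpt).trans (le_of_eq ?_)
  rw [lintegral_const_mul _ (Finset.measurable_sum _ fun i _ =>
    measurable_const.indicator (hE i)), lintegral_finsetSum _ fun i _ =>
    measurable_const.indicator (hE i)]
  congr 1
  refine Finset.sum_congr rfl fun i _ => ?_
  rw [lintegral_indicator_const (hE i), Measure.restrict_apply (hE i)]

end Averages

/-! ### Curves from the Hardy and Poincaré inequalities -/

section CurvesFromInequalities

open Metric

variable {X : Type*} [MetricSpace X]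

theorem exists_joinedWithCost_of_iInf_lt {g : X → ℝ} {ν : ℝ} (hν : 0 ≤ ν) {x y : X} {c : ℝ≥0∞}
    (h : (⨅ γ ∈ curvesToPoint ν x y, γ.lineIntegral g) < c) :
    JoinedWithCost g x y (ν * dist x y) c := by
  simp only [iInf_lt_iff] at h
  obtain ⟨γ, ⟨h1, h2, h3⟩, h4⟩ := h
  exact (joinedWithCost_iff (by positivity)).2 ⟨γ, h1, h2, h3, h4.le⟩

theorem iInf_lineIntegral_le {g : X → ℝ} {ν : ℝ} (hν : 0 ≤ ν) {x y : X} {Z : Set X} (hy : y ∈ Z)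
    {c : ℝ≥0∞} (h : JoinedWithCost g x y (ν * infDist x Z) c) :
    (⨅ γ ∈ curvesToSet ν x Z, γ.lineIntegral g) ≤ c := by
  obtain ⟨γ, h1, h2, h3, h4⟩ := (joinedWithCost_iff (mul_nonneg hν infDist_nonneg)).1 h
  exact (iInf₂_le γ ⟨h1, h2 ▸ hy, h3⟩).trans h4

theorem HasUnitSpeedOn.exists_first_mem {σ : ℝ → X} {L : ℝ} (hL : 0 ≤ L)
    (hσ : HasUnitSpeedOn σ (Icc 0 L)) {Z : Set X} (hZ : IsClosed Z) (h : σ L ∈ Z) :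
    ∃ L' ∈ Icc 0 L, σ L' ∈ Z ∧ ∀ t ∈ Ico 0 L', σ t ∉ Z := by
  have hc : IsClosed (Icc 0 L ∩ σ ⁻¹' Z) :=
    hσ.continuousOn_Icc.preimage_isClosed_of_isClosed isClosed_Icc hZ
  have hb : BddBelow (Icc 0 L ∩ σ ⁻¹' Z) := ⟨0, fun t ht => ht.1.1⟩
  have hm := hc.csInf_mem ⟨L, right_mem_Icc.2 hL, h⟩ hb
  refine ⟨_, hm.1, hm.2, fun t ht htZ => ?_⟩
  exact absurd (csInf_le hb ⟨⟨ht.1, ht.2.le.trans hm.1.2⟩, htZ⟩) (not_le.2 ht.2)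

theorem HasUnitSpeedOn.measurableSet_preimage {σ : ℝ → X} {L : ℝ}
    (hσ : HasUnitSpeedOn σ (Icc 0 L)) {E : Set X} (hE : IsOpen E) :
    MeasurableSet (Icc 0 L ∩ σ ⁻¹' E) := by
  obtain ⟨u, hu, hu'⟩ := continuousOn_iff'.1 hσ.continuousOn_Icc E hE
  rw [inter_comm, hu']
  exact hu.measurableSet.inter measurableSet_Icc

variable [MeasurableSpace X] [BorelSpace X] {μ : Measure X} {Ω : Set X} {w : X → ℝ≥0∞}

/-- A curve supplied by a Hardy inequality spends little time in one of the open sets `E i`, if the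
densities of these sets around `x` decay like `M ^ (-i p)`: the inequality is applied to
`∑ M ^ i 1_{E i}`, and one of the summands is at most the average of the summands. -/
theorem exists_path_to_boundary (hΩ : IsOpen Ω) (hw : Measurable w) {κ' : ℝ} {A B : ℝ≥0∞}
    (hW : IsDoublingIn (μ.withDensity w) Ω κ' A) {p C ν κ : ℝ} (hp : 0 < p) (hC : 0 < C)
    (hν : 0 ≤ ν) (hκ : κ ≤ κ')
    (hHardy : ∀ g : X → ℝ, LowerSemicontinuous g → (∀ y, 0 ≤ g y) → BddAbove (range g) →
      ∀ x ∈ Ω, (⨅ γ ∈ curvesToSet ν x Ωᶜ, γ.lineIntegral g) ≤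
          ENNReal.ofReal C * ENNReal.ofReal (infDist x Ωᶜ) * maximalFunction μ Ω w p κ g x)
    {E : ℕ → Set X} (hE : ∀ i, IsOpen (E i)) {S : Finset ℕ} {M : ℝ} (hM : 2 ≤ M)
    {x : X} (hx : x ∈ Ω) (hd : 0 < infDist x Ωᶜ) {H δ : ℝ} (hH : 0 < H)
    (hweak : ∀ i ∈ S, ∀ r, 0 < r → r < κ * infDist x Ωᶜ →
      ENNReal.ofReal (M ^ i) ^ p * μ.withDensity w (E i ∩ ball x r)
        ≤ B * μ.withDensity w (ball x r))
    (hBH : 2 ^ p * (S.card * B) ≤ ENNReal.ofReal H ^ p) (hδ : 2 * C * H ≤ S.card * δ) :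
    ∃ i ∈ S, ∃ (σ : ℝ → X) (L : ℝ), 0 ≤ L ∧ L ≤ ν * infDist x Ωᶜ ∧ HasUnitSpeedOn σ (Icc 0 L) ∧
      σ 0 = x ∧ σ L ∈ Ωᶜ ∧ (∀ t ∈ Ico 0 L, σ t ∈ Ω) ∧
      volume (Icc 0 L ∩ σ ⁻¹' E i) ≤ ENNReal.ofReal (δ / M ^ i * infDist x Ωᶜ) := by
  set d := infDist x Ωᶜ with hd_def
  have hM0 : 0 < M := by linarith
  have hind : ∀ i y, 0 ≤ (E i).indicator (fun _ => M ^ i) y := fun i y =>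
    indicator_nonneg (fun _ _ => (pow_pos hM0 i).le) y
  set h : X → ℝ := fun y => ∑ i ∈ S, (E i).indicator (fun _ => M ^ i) y with hh
  have hlsc : LowerSemicontinuous h := lowerSemicontinuous_sum fun i _ =>
    (hE i).lowerSemicontinuous_indicator (pow_pos hM0 i).le
  have hmax : maximalFunction μ Ω w p κ h x ≤ ENNReal.ofReal H := by
    refine iSup₂_le fun r hr => ?_
    rw [weightedAverage_le_iff hw hlsc.measurable hp
      (hW.pos x hx r hr.1 (hr.2.le.trans (by gcongr))).ne' (hW.lt_top x r).ne]
    refine (setLIntegral_sum_indicator_rpow_le (fun i => (hE i).measurableSet) hM hp S).trans ?_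
    calc 2 ^ p * ∑ i ∈ S, ENNReal.ofReal (M ^ i) ^ p * μ.withDensity w (E i ∩ ball x r)
        ≤ 2 ^ p * ∑ i ∈ S, B * μ.withDensity w (ball x r) := by
          exact mul_le_mul' le_rfl (Finset.sum_le_sum fun i hi => hweak i hi r hr.1 hr.2)
      _ = 2 ^ p * (S.card * B) * μ.withDensity w (ball x r) := by
          rw [Finset.sum_const, nsmul_eq_mul]; ring
      _ ≤ _ := by gcongr
  -- the factor `2` leaves room for an almost minimizing curve
  have hlt : (⨅ γ ∈ curvesToSet ν x Ωᶜ, γ.lineIntegral h) < ENNReal.ofReal (2 * C * H * d) := by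
    refine (hHardy h hlsc (fun y => Finset.sum_nonneg fun i _ => hind i y) ?_ x hx).trans_lt ?_
    · refine ⟨∑ i ∈ S, M ^ i, ?_⟩
      rintro _ ⟨y, rfl⟩
      exact Finset.sum_le_sum fun i _ => indicator_le_self' (fun _ _ => (pow_pos hM0 i).le) y
    · calc _ ≤ ENNReal.ofReal C * ENNReal.ofReal d * ENNReal.ofReal H := by gcongr
        _ = ENNReal.ofReal (C * d * H) := by
          rw [← ENNReal.ofReal_mul hC.le, ← ENNReal.ofReal_mul (by positivity)]
        _ < _ := by
          rw [ENNReal.ofReal_lt_ofReal_iff (by positivity)]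
          nlinarith [mul_pos (mul_pos hC hH) hd]
  simp only [iInf_lt_iff] at hlt
  obtain ⟨γ, ⟨hγa, hγb, hγl⟩, hγi⟩ := hlt
  obtain ⟨σ, L, hL, hLν, hσ, hσ0, hσL, hσi⟩ :=
    (joinedWithCost_iff (mul_nonneg hν hd.le)).2 ⟨γ, hγa, rfl, hγl, hγi.le⟩
  have hsum : ∑ i ∈ S, ENNReal.ofReal (M ^ i) * volume (Icc 0 L ∩ σ ⁻¹' E i)
      ≤ ENNReal.ofReal (2 * C * H * d) := by
    refine le_trans (le_of_eq ?_) hσi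
    have : ∀ t ∈ Icc 0 L, ENNReal.ofReal (h (σ t)) =
        ∑ i ∈ S, (Icc 0 L ∩ σ ⁻¹' E i).indicator (fun _ => ENNReal.ofReal (M ^ i)) t := by
      intro t ht
      rw [ENNReal.ofReal_sum_of_nonneg fun i _ => hind i _]
      refine Finset.sum_congr rfl fun i _ => ?_
      by_cases hi : σ t ∈ E i
      · rw [indicator_of_mem hi, indicator_of_mem (s := Icc 0 L ∩ σ ⁻¹' E i) ⟨ht, hi⟩]
      · rw [indicator_of_notMem hi,
          indicator_of_notMem (s := Icc 0 L ∩ σ ⁻¹' E i) fun hh => hi hh.2,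
          ENNReal.ofReal_zero]
    rw [setLIntegral_congr_fun measurableSet_Icc this, lintegral_finsetSum _ fun i _ =>
      measurable_const.indicator (hσ.measurableSet_preimage (hE i))]
    refine Finset.sum_congr rfl fun i _ => ?_
    rw [lintegral_indicator_const (hσ.measurableSet_preimage (hE i)),
      Measure.restrict_apply (hσ.measurableSet_preimage (hE i)),
      inter_eq_left.2 inter_subset_left]
  -- if all summands exceeded `δ d`, then their sum would exceed `2 C H d`
  have hex : ∃ i ∈ S, volume (Icc 0 L ∩ σ ⁻¹' E i) ≤ ENNReal.ofReal (δ / M ^ i * d) := by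
    by_contra! hcon
    have hS : S.Nonempty := by
      rw [Finset.nonempty_iff_ne_empty]
      rintro rfl
      simp only [Finset.card_empty, Nat.cast_zero, zero_mul] at hδ
      nlinarith [mul_pos hC hH]
    have hcard : (0 : ℝ) < S.card := by exact_mod_cast hS.card_pos
    have hδ0 : 0 < δ := by
      by_contra hneg
      nlinarith [mul_pos hC hH]
    have : ∑ i ∈ S, ENNReal.ofReal (δ * d)
        < ∑ i ∈ S, ENNReal.ofReal (M ^ i) * volume (Icc 0 L ∩ σ ⁻¹' E i) := by
      refine ENNReal.sum_lt_sum_of_nonempty hS fun i hi => ?_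
      have hpos := pow_pos hM0 i
      calc ENNReal.ofReal (δ * d) = ENNReal.ofReal (M ^ i) * ENNReal.ofReal (δ / M ^ i * d) := by
            rw [← ENNReal.ofReal_mul hpos.le]; congr 1; field_simp
        _ < _ := ENNReal.mul_lt_mul_right (by simpa using hpos) ENNReal.ofReal_ne_top (hcon i hi)
    rw [Finset.sum_const, nsmul_eq_mul] at this
    refine absurd (this.trans_le hsum) (not_lt.2 ?_)
    rw [← ENNReal.ofReal_natCast, ← ENNReal.ofReal_mul hcard.le]
    exact ENNReal.ofReal_le_ofReal (by nlinarith)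
  obtain ⟨i, hi, hvol⟩ := hex
  obtain ⟨L', hL', hσL', hfirst⟩ :=
    hσ.exists_first_mem hL hΩ.isClosed_compl (show σ L ∈ Ωᶜ from hσL ▸ hγb)
  refine ⟨i, hi, σ, L', hL'.1, hL'.2.trans hLν, hσ.mono_Icc le_rfl hL'.2, hσ0, hσL',
    fun t ht => not_not.1 (hfirst t ht), le_trans (measure_mono ?_) hvol⟩
  exact inter_subset_inter_left _ (Icc_subset_Icc_right hL'.2)

/-- Two points at which the local averages of `g` are at most `c` are joined by a curve along which
`g` has average at most a multiple of `c`, by the Poincaré inequality. -/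
theorem joinedWithCost_of_poincare (hw : Measurable w) {κ' : ℝ} {A : ℝ≥0∞}
    (hW : IsDoublingIn (μ.withDensity w) Ω κ' A) {p₀ q C ν κ : ℝ} (hp₀ : 1 ≤ p₀) (hq : p₀ ≤ q)
    (hC : 0 < C) (hν : 0 ≤ ν) (hκ : κ ≤ κ')
    (hPoincare : ∀ g : X → ℝ, LowerSemicontinuous g → (∀ y, 0 ≤ g y) → BddAbove (range g) →
      ∀ x ∈ Ω, ∀ y ∈ Ω, dist x y < infDist x Ωᶜ / (3 * κ) →
        (⨅ γ ∈ curvesToPoint ν x y, γ.lineIntegral g) ≤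
          ENNReal.ofReal C * ENNReal.ofReal (dist x y) *
            (maximalFunctionUpTo μ Ω w p₀ κ (κ * dist x y) g x +
              maximalFunctionUpTo μ Ω w p₀ κ (κ * dist x y) g y))
    {g : X → ℝ} (hg : LowerSemicontinuous g) (hg0 : ∀ y, 0 ≤ g y) (hgb : BddAbove (range g))
    {y z : X} (hy : y ∈ Ω) (hz : z ∈ Ω) (hyz : dist y z < infDist y Ωᶜ / (3 * κ)) {c m : ℝ}
    (hc : 0 < c) (hm : 0 < m) (hdm : dist y z ≤ m)
    (hay : ∀ s, 0 < s → s < κ * infDist y Ωᶜ → s < κ * dist y z →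
      ∫⁻ u in ball y s, ‖g u‖ₑ ^ q ∂(μ.withDensity w)
        ≤ ENNReal.ofReal c ^ q * μ.withDensity w (ball y s))
    (haz : ∀ s, 0 < s → s < κ * infDist z Ωᶜ → s < κ * dist y z →
      ∫⁻ u in ball z s, ‖g u‖ₑ ^ q ∂(μ.withDensity w)
        ≤ ENNReal.ofReal c ^ q * μ.withDensity w (ball z s)) :
    JoinedWithCost g y z (ν * m) (ENNReal.ofReal (5 * C * c) * ENNReal.ofReal m) := by
  have hmax : ∀ v ∈ Ω, (∀ s, 0 < s → s < κ * infDist v Ωᶜ → s < κ * dist y z →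
      ∫⁻ u in ball v s, ‖g u‖ₑ ^ q ∂(μ.withDensity w)
        ≤ ENNReal.ofReal c ^ q * μ.withDensity w (ball v s)) →
      maximalFunctionUpTo μ Ω w p₀ κ (κ * dist y z) g v ≤ 2 * ENNReal.ofReal c := by
    intro v hv hav
    refine iSup₂_le fun s hs => ?_
    obtain ⟨hs1, hs2⟩ := lt_min_iff.1 hs.2
    have hd : 0 ≤ infDist v Ωᶜ := infDist_nonneg
    rw [weightedAverage_le_iff hw hg.measurable (by linarith)
      (hW.pos v hv s hs.1 (hs1.le.trans (by gcongr))).ne' (hW.lt_top v s).ne]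
    exact setLIntegral_rpow_le_of_le hg.measurable.enorm (fun _ => enorm_ne_top) hp₀ hq
      (by simpa using hc) ENNReal.ofReal_ne_top (hav s hs.1 hs1 hs2)
  -- the bound `4 C c` is enlarged to `5 C c` to make room for an almost minimizing curve
  have hlt : (⨅ γ ∈ curvesToPoint ν y z, γ.lineIntegral g)
      < ENNReal.ofReal (5 * C * c) * ENNReal.ofReal m := by
    refine (hPoincare g hg hg0 hgb y hy z hz hyz).trans_lt ?_
    calc _ ≤ ENNReal.ofReal C * ENNReal.ofReal m
          * (2 * ENNReal.ofReal c + 2 * ENNReal.ofReal c) := by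
          gcongr
          · exact hmax y hy hay
          · exact hmax z hz haz
      _ = ENNReal.ofReal (4 * C * c * m) := by
          rw [← add_mul, show (2 : ℝ≥0∞) + 2 = ENNReal.ofReal 4 by norm_num,
            ← ENNReal.ofReal_mul hC.le, ← ENNReal.ofReal_mul (by norm_num),
            ← ENNReal.ofReal_mul (by positivity)]
          congr 1; ring
      _ < _ := by
          rw [← ENNReal.ofReal_mul (by positivity), ENNReal.ofReal_lt_ofReal_iff (by positivity)]
          nlinarith [mul_pos (mul_pos hC hc) hm]
  exact (exists_joinedWithCost_of_iInf_lt hν hlt).mono (by gcongr) le_rfl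

end CurvesFromInequalities

/-! ### The recursive estimate for `α` -/

section Improvement

open Metric

variable {X : Type*} [MetricSpace X] [MeasurableSpace X]

/-- Each `x ∈ Ω` can be joined to the complement of `Ω` by a curve of length at most `N d(x, Ωᶜ)`
along which the test function `g` has integral at most `c d(x, Ωᶜ)`. Up to the choice of almost
minimizing curves this says that `α(N, K, τ) ≤ c`. -/
def BoundaryCostLE (μ : Measure X) (Ω : Set X) (w : X → ℝ≥0∞) (q N K τ c : ℝ) : Prop :=
  ∀ x ∈ Ω, ∀ g ∈ testClass μ Ω w q K τ x, ∃ y ∈ Ωᶜ,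
    JoinedWithCost g x y (N * infDist x Ωᶜ) (ENNReal.ofReal (c * infDist x Ωᶜ))

variable {μ : Measure X} {Ω : Set X} {w : X → ℝ≥0∞}

theorem alphaFunction_le_of_boundaryCostLE {q N K τ c : ℝ} (hN : 0 ≤ N) (hc : 0 ≤ c)
    (h : BoundaryCostLE μ Ω w q N K τ c) :
    alphaFunction μ Ω w q N K τ ≤ ENNReal.ofReal c := by
  refine iSup₂_le fun x hx => iSup₂_le fun g hg => ENNReal.div_le_of_le_mul ?_
  obtain ⟨y, hy, hj⟩ := h x hx g hg
  rw [← ENNReal.ofReal_mul hc]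
  exact iInf_lineIntegral_le hN hy hj

theorem infDist_compl_pos {X : Type*} [MetricSpace X] {Ω : Set X} (hΩ : IsOpen Ω)
    (hΩX : Ω ≠ univ) {x : X} (hx : x ∈ Ω) :
    0 < infDist x Ωᶜ :=
  (hΩ.isClosed_compl.notMem_iff_infDist_pos (nonempty_compl.2 hΩX)).1 (not_not.2 hx)

/-- Test functions take values in `[0, 1]`, so for `τ ≥ 1` quasiconvexity suffices. -/
theorem boundaryCostLE_of_one_le (hΩ : IsOpen Ω) (hΩX : Ω ≠ univ) {Cqc N Cα : ℝ} (hCqc : 1 ≤ Cqc)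
    (hX : IsQuasiconvexSpace X Cqc) (hN : Cqc < N) (hNα : N ≤ Cα) {q K τ : ℝ} (hτ : 1 ≤ τ) :
    BoundaryCostLE μ Ω w q N K τ (Cα * τ) := by
  rintro x hx g ⟨-, -, hg01⟩
  have hd := infDist_compl_pos hΩ hΩX hx
  obtain ⟨y, hy, hxy⟩ := (infDist_lt_iff (nonempty_compl.2 hΩX) (x := x)
      (r := N / Cqc * infDist x Ωᶜ)).1 (by
    have : 1 < N / Cqc := (one_lt_div (by linarith)).2 hN
    nlinarith)
  obtain ⟨γ, h1, h2, h3⟩ := hX x y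
  have hlen : Cqc * dist x y ≤ N * infDist x Ωᶜ := by
    calc Cqc * dist x y ≤ Cqc * (N / Cqc * infDist x Ωᶜ) := by gcongr
      _ = _ := by field_simp
  refine ⟨y, hy, (joinedWithCost_iff (mul_nonneg (by linarith) hd.le)).2
    ⟨γ, h1, h2, h3.trans (ENNReal.ofReal_le_ofReal hlen), ?_⟩⟩
  have hlt : γ.length ≠ ∞ := γ.rectifiable
  calc γ.lineIntegral g ≤ ∫⁻ _ in Icc (0 : ℝ) γ.length.toReal, 1 :=
        lintegral_mono fun t => ENNReal.ofReal_le_one.2 (hg01 _).2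
    _ = γ.length := by simp [hlt]
    _ ≤ ENNReal.ofReal (N * infDist x Ωᶜ) := h3.trans (ENNReal.ofReal_le_ofReal hlen)
    _ ≤ _ := by
        refine ENNReal.ofReal_le_ofReal ?_
        have : N ≤ Cα * τ := by nlinarith
        gcongr

variable [BorelSpace X]

theorem setLIntegral_le_of_maximalFunction_le (hw : Measurable w) {K q τ : ℝ} {κ' : ℝ}
    {A : ℝ≥0∞} (hW : IsDoublingIn (μ.withDensity w) Ω κ' A) (hK : K ≤ κ') (hq : 0 < q) {g : X → ℝ}
    (hg : Measurable g) {x : X} (hx : x ∈ Ω)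
    (h : maximalFunction μ Ω w q K g x ≤ ENNReal.ofReal τ) {r : ℝ} (hr : 0 < r)
    (hrK : r < K * infDist x Ωᶜ) :
    ∫⁻ y in ball x r, ‖g y‖ₑ ^ q ∂(μ.withDensity w)
      ≤ ENNReal.ofReal τ ^ q * μ.withDensity w (ball x r) := by
  have hd : 0 ≤ infDist x Ωᶜ := infDist_nonneg
  rw [← weightedAverage_le_iff hw hg hq
    (hW.pos x hx r hr (hrK.le.trans (by gcongr))).ne' (hW.lt_top x r).ne]
  exact (le_iSup₂ (f := fun (r : ℝ) (_ : 0 < r ∧ r < K * infDist x Ωᶜ) =>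
    weightedAverage μ w q g x r) r ⟨hr, hrK⟩).trans h

/-- The Hardy inequality with exponent `p`, applied to the high sets of `g` with exponent `q < p`
and the levels `M ^ i τ`, yields a curve to the boundary that avoids one of these sets for most of
the time. The condition `(M ^ k) ^ (p - q) ≤ 2` says that passing from `q` to `p` is harmless for
the first `k` levels, and `hk` says that there are enough levels to gain the small factor `δ`. -/
theorem exists_path_avoiding_highSet (hΩ : IsOpen Ω) (hw : Measurable w)
    {p q CH νH κH K D M H δ τ : ℝ} {k : ℕ} (hq : 1 ≤ q) (hqp : q < p)
    (hCH : 0 < CH) (hνH : 0 ≤ νH) (hκH : 0 < κH)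
    (hHardy : ∀ g : X → ℝ, LowerSemicontinuous g → (∀ y, 0 ≤ g y) → BddAbove (range g) →
      ∀ x ∈ Ω, (⨅ γ ∈ curvesToSet νH x Ωᶜ, γ.lineIntegral g) ≤
          ENNReal.ofReal CH * ENNReal.ofReal (infDist x Ωᶜ) * maximalFunction μ Ω w p κH g x)
    (hK : 3 * κH ≤ K)
    (hW : IsDoublingIn (μ.withDensity w) Ω (16 * K) (ENNReal.ofReal D))
    (hM : 2 ≤ M) (hMD : D ^ 3 ≤ M) (hMq : (M ^ k) ^ (p - q) ≤ 2) (hH : 0 < H)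
    (hDH : 2 ^ p * (k * (2 * ENNReal.ofReal D ^ 7)) ≤ ENNReal.ofReal H ^ p)
    (hk : 2 * CH * H ≤ k * δ) (hτ : 0 < τ) {x : X} (hx : x ∈ Ω) (hd : 0 < infDist x Ωᶜ)
    {g : X → ℝ} (hg : LowerSemicontinuous g)
    (hgx : maximalFunction μ Ω w q K g x ≤ ENNReal.ofReal τ) :
    ∃ i ∈ Finset.Icc 1 k, ∃ E : Set X, E = highSet (μ.withDensity w) Ω (fun u => ‖g u‖ₑ ^ q) K
        (κH * infDist x Ωᶜ) (ENNReal.ofReal (M ^ i * τ) ^ q) ∧ x ∉ E ∧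
      ∃ (σ : ℝ → X) (L : ℝ), 0 ≤ L ∧ L ≤ νH * infDist x Ωᶜ ∧
        HasUnitSpeedOn σ (Icc 0 L) ∧ σ 0 = x ∧ σ L ∈ Ωᶜ ∧ (∀ t ∈ Ico 0 L, σ t ∈ Ω) ∧
        volume (Icc 0 L ∩ σ ⁻¹' E) ≤ ENNReal.ofReal (δ / M ^ i * infDist x Ωᶜ) := by
  set d := infDist x Ωᶜ with hd_def
  have hq0 : 0 < q := by linarith
  have hM0 : 0 < M := by linarith
  have hK0 : 0 < K := by linarith
  set W := μ.withDensity w with hW_def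
  -- the hypothesis on `g` in terms of integrals
  have hint : ∀ ρ, 0 < ρ → ρ < K * d →
      ∫⁻ u in ball x ρ, ‖g u‖ₑ ^ q ∂W ≤ ENNReal.ofReal τ ^ q * W (ball x ρ) := fun ρ h1 h2 =>
    setLIntegral_le_of_maximalFunction_le hw hW (by linarith) hq0 hg.measurable hx hgx h1 h2
  set R := κH * d with hR
  have hRK : 3 * R ≤ K * d := by rw [hR]; nlinarith
  set lev : ℕ → ℝ≥0∞ := fun i => ENNReal.ofReal (M ^ i * τ) ^ q with hlev
  have hlev_eq : ∀ i, lev i = ENNReal.ofReal (M ^ i) ^ q * ENNReal.ofReal τ ^ q := fun i => by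
    rw [hlev]
    simp only
    rw [ENNReal.ofReal_mul (pow_pos hM0 i).le, ENNReal.mul_rpow_of_nonneg _ _ hq0.le]
  have hτq0 : ENNReal.ofReal τ ^ q ≠ 0 :=
    (ENNReal.rpow_pos (ENNReal.ofReal_pos.2 hτ) ENNReal.ofReal_ne_top).ne'
  have hτqt : ENNReal.ofReal τ ^ q ≠ ∞ := ENNReal.rpow_ne_top_of_nonneg hq0.le ENNReal.ofReal_ne_top
  have hlevA : ∀ i ∈ Finset.Icc 1 k, ENNReal.ofReal D ^ 3 * ENNReal.ofReal τ ^ q ≤ lev i := by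
    intro i hi
    have hD0 : 0 ≤ D := by
      by_contra h
      have := hW.one_le
      rw [ENNReal.ofReal_of_nonpos (not_le.1 h).le] at this
      simp at this
    rw [hlev_eq i]
    gcongr ?_ * _
    have hMi : D ^ 3 ≤ M ^ i := hMD.trans (le_self_pow₀ (by linarith)
      (by have := (Finset.mem_Icc.1 hi).1; omega))
    calc ENNReal.ofReal D ^ 3 = ENNReal.ofReal (D ^ 3) := (ENNReal.ofReal_pow hD0 3).symm
      _ ≤ ENNReal.ofReal (M ^ i) := ENNReal.ofReal_le_ofReal hMi
      _ = ENNReal.ofReal (M ^ i) ^ (1 : ℝ) := (ENNReal.rpow_one _).symm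
      _ ≤ ENNReal.ofReal (M ^ i) ^ q := ENNReal.rpow_le_rpow_of_exponent_le
          (ENNReal.one_le_ofReal.2 (one_le_pow₀ (by linarith))) (by linarith)
  set E : ℕ → Set X := fun i => highSet W Ω (fun u => ‖g u‖ₑ ^ q) K R (lev i) with hE
  -- passing from `q` to `p` costs only a factor `2` for the finitely many levels in use
  have hweak : ∀ i ∈ Finset.Icc 1 k, ∀ r, 0 < r → r < κH * d →
      ENNReal.ofReal (M ^ i) ^ p * W (E i ∩ ball x r)
        ≤ 2 * ENNReal.ofReal D ^ 7 * W (ball x r) := by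
    intro i hi r hr hrR
    have h1 := measure_highSet_inter_ball_le hW hx hRK hint (hlevA i hi) hr hrR
    have h2 : ENNReal.ofReal (M ^ i) ^ q * W (E i ∩ ball x r)
        ≤ ENNReal.ofReal D ^ 7 * W (ball x r) := by
      have h1 : ENNReal.ofReal (M ^ i) ^ q * ENNReal.ofReal τ ^ q * W (E i ∩ ball x r)
          ≤ ENNReal.ofReal D ^ 7 * ENNReal.ofReal τ ^ q * W (ball x r) := hlev_eq i ▸ h1
      refine (ENNReal.mul_le_mul_iff_right hτq0 hτqt).1 ?_
      calc _ = ENNReal.ofReal (M ^ i) ^ q * ENNReal.ofReal τ ^ q * W (E i ∩ ball x r) := by ring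
        _ ≤ ENNReal.ofReal D ^ 7 * ENNReal.ofReal τ ^ q * W (ball x r) := h1
        _ = _ := by ring
    have h3 : ENNReal.ofReal (M ^ i) ^ (p - q) ≤ 2 := by
      rw [ENNReal.ofReal_rpow_of_pos (pow_pos hM0 i)]
      refine (ENNReal.ofReal_le_ofReal (q := 2) ?_).trans (by simp)
      refine le_trans ?_ hMq
      exact Real.rpow_le_rpow (pow_pos hM0 i).le
        (pow_le_pow_right₀ (by linarith) (Finset.mem_Icc.1 hi).2) (by linarith)
    have hMi0 : ENNReal.ofReal (M ^ i) ≠ 0 := by simpa using pow_pos hM0 i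
    calc ENNReal.ofReal (M ^ i) ^ p * W (E i ∩ ball x r)
        = ENNReal.ofReal (M ^ i) ^ (p - q) * (ENNReal.ofReal (M ^ i) ^ q * W (E i ∩ ball x r)) := by
          rw [← mul_assoc, ← ENNReal.rpow_add _ _ hMi0 ENNReal.ofReal_ne_top]
          congr 2; ring
      _ ≤ 2 * (ENNReal.ofReal D ^ 7 * W (ball x r)) := by gcongr
      _ = _ := by ring
  obtain ⟨i, hi, σ, L, hL, hLν, hσ, hσ0, hσL, hσΩ, hvol⟩ := exists_path_to_boundary hΩ hw hW
    (by linarith) hCH (by linarith) (by linarith : κH ≤ 16 * K) hHardy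
    (fun i => isOpen_highSet hΩ) hM hx hd hH hweak (by simpa using hDH) (by simpa using hk)
  exact ⟨i, hi, E i, rfl, notMem_highSet_self hW hRK hint (hlevA i hi), σ, L, hL, hLν, hσ, hσ0, hσL,
    hσΩ, hvol⟩

/-- The recursive estimate behind the self-improvement: if test functions at the higher levels
`M ^ i τ`, `1 ≤ i ≤ k`, admit good curves to the boundary, then so do test functions at the level
`τ`, with the same constants `N` and `Cα`. -/
theorem boundaryCostLE_step (hΩ : IsOpen Ω) (hΩX : Ω ≠ univ) (hw : Measurable w)
    {p₀ p q CP νP κP CH νH κH K D M H Cα τ : ℝ} {k : ℕ}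
    (hp₀ : 1 ≤ p₀) (hp₀q : p₀ ≤ q) (hqp : q < p)
    (hCP : 0 < CP) (hνP : 1 ≤ νP) (hκP : 1 < κP) (hCH : 0 < CH) (hνH : 1 ≤ νH) (hκH : 1 < κH)
    (hPoincare : ∀ g : X → ℝ, LowerSemicontinuous g → (∀ y, 0 ≤ g y) → BddAbove (range g) →
      ∀ x ∈ Ω, ∀ y ∈ Ω, dist x y < infDist x Ωᶜ / (3 * κP) →
        (⨅ γ ∈ curvesToPoint νP x y, γ.lineIntegral g) ≤
          ENNReal.ofReal CP * ENNReal.ofReal (dist x y) *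
            (maximalFunctionUpTo μ Ω w p₀ κP (κP * dist x y) g x +
              maximalFunctionUpTo μ Ω w p₀ κP (κP * dist x y) g y))
    (hHardy : ∀ g : X → ℝ, LowerSemicontinuous g → (∀ y, 0 ≤ g y) → BddAbove (range g) →
      ∀ x ∈ Ω, (⨅ γ ∈ curvesToSet νH x Ωᶜ, γ.lineIntegral g) ≤
          ENNReal.ofReal CH * ENNReal.ofReal (infDist x Ωᶜ) * maximalFunction μ Ω w p κH g x)
    (hK1 : 3 * κH ≤ K) (hK2 : κP ≤ K)
    (hW : IsDoublingIn (μ.withDensity w) Ω (16 * K) (ENNReal.ofReal D))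
    (hM : 2 ≤ M) (hMD : D ^ 3 ≤ M) (hMq : (M ^ k) ^ (p - q) ≤ 2) (hH : 0 < H)
    (hDH : 2 ^ p * (k * (2 * ENNReal.ofReal D ^ 7)) ≤ ENNReal.ofReal H ^ p)
    (hk : 2 * CH * H ≤ k * (1 / (6 * κP * K)))
    (hCα : 2 * (M ^ k * (νH + 5 * CP + 1)) ≤ Cα) (hτ : 0 < τ)
    (hrec : ∀ i ∈ Finset.Icc 1 k,
      BoundaryCostLE μ Ω w q (2 * νP * νH) K (M ^ i * τ) (Cα * (M ^ i * τ))) :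
    BoundaryCostLE μ Ω w q (2 * νP * νH) K τ (Cα * τ) := by
  rintro x hx g ⟨hg, hgx, hg01⟩
  have hdpos : ∀ y ∈ Ω, 0 < infDist y Ωᶜ := fun y hy => infDist_compl_pos hΩ hΩX hy
  have hd := hdpos x hx
  set d := infDist x Ωᶜ with hd_def
  have hq0 : 0 < q := by linarith
  have hM0 : 0 < M := by linarith
  have hK0 : 0 < K := by linarith
  set W := μ.withDensity w with hW_def
  set δ := 1 / (6 * κP * K) with hδ_def
  have hδ : 0 < δ := by positivity
  have hδK : 3 * κP * δ * K = 1 / 2 := by rw [hδ_def]; field_simp; norm_num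
  have hδ1 : 3 * κP * δ ≤ 1 / 2 := by
    rw [← hδK]
    have : 0 < 3 * κP * δ := by positivity
    nlinarith
  have hδ2 : δ ≤ 1 := by nlinarith
  have hκδ : κP * δ ≤ 1 := by
    have : 0 < κP * δ := by positivity
    linarith
  obtain ⟨i, hi, E, hE, hxE, σ, L, hL, hLν, hσ, hσ0, hσL, hσΩ, hvol⟩ :=
    exists_path_avoiding_highSet hΩ hw (hp₀.trans hp₀q) hqp hCH (by linarith) (by linarith) hHardy
      hK1 hW hM hMD hMq hH hDH hk hτ hx hd hg hgx
  clear hHardy hDH hk hMq hMD hgx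
  have hEo : IsOpen E := hE ▸ isOpen_highSet hΩ
  have hEΩ : E ⊆ Ω := fun y hy => (hE ▸ hy : y ∈ highSet _ _ _ _ _ _).1
  set R := κH * d with hR
  have hMi1 : 1 ≤ M ^ i := one_le_pow₀ (by linarith)
  have hMi0 : 0 < M ^ i := by linarith
  set lam := M ^ i * τ with hlam
  have hlam0 : 0 < lam := by positivity
  have hvold : δ / M ^ i * d ≤ d := by
    have : δ / M ^ i ≤ 1 := (div_le_one hMi0).2 (by linarith)
    nlinarith
  have havg : ∀ y ∈ Ω, y ∉ E → ∀ s, 0 < s → s < K * infDist y Ωᶜ → s < R →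
      ∫⁻ u in ball y s, ‖g u‖ₑ ^ q ∂W ≤ ENNReal.ofReal lam ^ q * W (ball y s) :=
    fun y hy hyE s h1 h2 h3 => setLIntegral_le_of_notMem_highSet hy (hE ▸ hyE) h1 h2 h3
  have hgE : ∀ y ∈ Ω, y ∉ E → g y ≤ lam := by
    intro y hy hyE
    have hy0 := hdpos y hy
    refine hg.le_of_setLIntegral_le (W := W) (q := q) (ρ := min (K * infDist y Ωᶜ) R) hlam0.le hq0
      (lt_min (by positivity) (by positivity)) (fun s h1 h2 => ?_) (fun s => hW.lt_top y s)
      (fun s h1 h2 => havg y hy hyE s h1 (lt_min_iff.1 h2).1 (lt_min_iff.1 h2).2)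
    refine hW.pos y hy s h1 ?_
    have h3 := (lt_min_iff.1 h2).1
    have : 0 < K * infDist y Ωᶜ := by positivity
    linarith
  -- the times that the path spends outside the high set
  set F := Icc 0 L ∩ σ ⁻¹' (E)ᶜ with hF
  have hFc : IsClosed F := hσ.continuousOn_Icc.preimage_isClosed_of_isClosed isClosed_Icc
    hEo.isClosed_compl
  have h0F : (0 : ℝ) ∈ F := by
    refine ⟨left_mem_Icc.2 hL, ?_⟩
    rw [mem_preimage, hσ0]
    exact hxE
  have hLF : L ∈ F := ⟨right_mem_Icc.2 hL, fun h => hσL (hEΩ h)⟩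
  have hU : Icc 0 L \ F = Icc 0 L ∩ σ ⁻¹' E := by
    ext t
    simp only [hF, mem_sdiff, mem_inter_iff, mem_preimage, mem_compl_iff]
    tauto
  rw [← hU] at hvol
  have hε : ENNReal.ofReal (lam * d) ≠ 0 := by
    have : 0 < lam * d := by positivity
    simpa using this
  obtain ⟨s, hsF, hjoin, hend⟩ := exists_joinedWithCost_until (ν := νP)
    (Λ := ENNReal.ofReal (5 * CP * lam)) hσ hFc inter_subset_left
    h0F hLF hνP (fun y => (hg01 y).2) (Λ₀ := ENNReal.ofReal lam)
    (fun u hu huL => ENNReal.ofReal_le_ofReal (hgE _ (hσΩ u ⟨hu.1.1, huL⟩) hu.2)) hε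
  have hcost : ENNReal.ofReal lam * ENNReal.ofReal L
      + ENNReal.ofReal (5 * CP * lam) * volume (Icc 0 L \ F) + ENNReal.ofReal (lam * d)
      ≤ ENNReal.ofReal (Cα / 2 * τ * d) := by
    calc _ ≤ ENNReal.ofReal lam * ENNReal.ofReal (νH * d)
          + ENNReal.ofReal (5 * CP * lam) * ENNReal.ofReal d + ENNReal.ofReal (lam * d) := by
          gcongr
          exact hvol.trans (ENNReal.ofReal_le_ofReal hvold)
      _ = ENNReal.ofReal (lam * (νH + 5 * CP + 1) * d) := by
          rw [← ENNReal.ofReal_mul hlam0.le, ← ENNReal.ofReal_mul (by positivity),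
            ← ENNReal.ofReal_add (by positivity) (by positivity),
            ← ENNReal.ofReal_add (by positivity) (by positivity)]
          congr 1; ring
      _ ≤ _ := by
          refine ENNReal.ofReal_le_ofReal ?_
          have hMk : M ^ i ≤ M ^ k :=
            pow_le_pow_right₀ (by linarith) (Finset.mem_Icc.1 hi).2
          have h1 : M ^ i * (νH + 5 * CP + 1) ≤ Cα / 2 := by
            have : M ^ i * (νH + 5 * CP + 1) ≤ M ^ k * (νH + 5 * CP + 1) := by gcongr
            linarith
          calc lam * (νH + 5 * CP + 1) * d = M ^ i * (νH + 5 * CP + 1) * τ * d := by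
                rw [hlam]; ring
            _ ≤ Cα / 2 * τ * d := by gcongr
  have hCα0 : 0 < Cα := lt_of_lt_of_le (by positivity) hCα
  have hsL : s ≤ L := hsF.1.2
  have hlen : νP * s ≤ νP * νH * d := by
    rw [mul_assoc]
    gcongr
    exact hsL.trans hLν
  rw [hσ0] at hjoin
  rcases hend with rfl | ⟨r, hrF, hsr, hIoo, hbad⟩
  · refine ⟨_, hσL, hjoin.mono ?_ (hcost.trans (ENNReal.ofReal_le_ofReal ?_))⟩
    · have : 0 < νP * νH * d := by positivity
      linarith
    · have : 0 < Cα * τ * d := by positivity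
      linarith
  · have hrL : r ≤ L := hrF.1.2
    have hsΩ : σ s ∈ Ω := hσΩ s ⟨hsF.1.1, by linarith⟩
    have hds := hdpos _ hsΩ
    have hdist : dist (σ s) (σ r) ≤ r - s := hσ.dist_le hsF.1.1 hsr.le hrL
    have hgap : r - s ≤ δ / M ^ i * d := by
      have := (measure_mono hIoo).trans hvol
      rw [Real.volume_Ioo, ENNReal.ofReal_le_ofReal_iff (by positivity)] at this
      exact this
    -- a gap that cannot be bridged is long compared to the distance to the boundary
    have hlong : infDist (σ s) Ωᶜ ≤ 3 * κP * (r - s) := by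
      by_contra hcon
      rw [not_le] at hcon
      have hlt : dist (σ s) (σ r) < infDist (σ s) Ωᶜ / (3 * κP) := by
        rw [lt_div_iff₀ (by positivity), mul_comm]
        exact (mul_le_mul_of_nonneg_left hdist (by positivity)).trans_lt hcon
      have hrΩ : σ r ∈ Ω := by
        by_contra h
        have h1 := infDist_le_dist_of_mem (x := σ s) (show σ r ∈ Ωᶜ from h)
        rw [lt_div_iff₀ (by positivity)] at hlt
        have h2 := le_mul_of_one_le_right (dist_nonneg (x := σ s) (y := σ r))
          (by linarith : 1 ≤ 3 * κP)
        linarith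
      have hκR : κP * dist (σ s) (σ r) ≤ R := by
        calc κP * dist (σ s) (σ r) ≤ κP * (δ / M ^ i * d) := by
              gcongr
              exact hdist.trans hgap
          _ ≤ κP * (δ * d) := by
              gcongr
              exact div_le_self hδ.le hMi1
          _ = κP * δ * d := by ring
          _ ≤ κH * d := by
              gcongr
              linarith
      have hav : ∀ y ∈ Ω, y ∉ E → ∀ ρ, 0 < ρ → ρ < κP * infDist y Ωᶜ →
          ρ < κP * dist (σ s) (σ r) →
          ∫⁻ u in ball y ρ, ‖g u‖ₑ ^ q ∂W ≤ ENNReal.ofReal lam ^ q * W (ball y ρ) := by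
        intro y hy hyE ρ h1 h2 h3
        refine havg y hy hyE ρ h1 (h2.trans_le ?_) (by linarith)
        have := hdpos y hy
        gcongr
      exact hbad (joinedWithCost_of_poincare hw hW hp₀ hp₀q hCP (by linarith)
        (by linarith : κP ≤ 16 * K) hPoincare hg (fun y => (hg01 y).1)
        ⟨1, by rintro _ ⟨y, rfl⟩; exact (hg01 y).2⟩ hsΩ hrΩ hlt hlam0 (by linarith) hdist
        (hav _ hsΩ hsF.2) (hav _ hrΩ hrF.2))
    have hds2 : infDist (σ s) Ωᶜ ≤ 3 * κP * δ / M ^ i * d := by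
      calc infDist (σ s) Ωᶜ ≤ 3 * κP * (δ / M ^ i * d) := hlong.trans (by gcongr)
        _ = _ := by ring
    have hds3 : infDist (σ s) Ωᶜ ≤ 3 * κP * δ * d := by
      refine hds2.trans ?_
      gcongr
      exact div_le_self (by positivity) hMi1
    -- `σ s` is so close to the boundary that all radii below `K d(σ s, Ωᶜ)` are below `R`
    have htest : g ∈ testClass μ Ω w q K (M ^ i * τ) (σ s) := by
      refine ⟨hg, iSup₂_le fun ρ hρ => ?_, hg01⟩
      rw [weightedAverage_le_iff hw hg.measurable hq0
        (hW.pos _ hsΩ ρ hρ.1 (hρ.2.le.trans (by gcongr; linarith))).ne' (hW.lt_top _ ρ).ne]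
      refine havg _ hsΩ hsF.2 ρ hρ.1 hρ.2 (hρ.2.trans_le ?_)
      calc K * infDist (σ s) Ωᶜ ≤ K * (3 * κP * δ * d) := by gcongr
        _ = 3 * κP * δ * K * d := by ring
        _ ≤ κH * d := by
            rw [hδK]
            gcongr
            linarith
    obtain ⟨z, hz, hjz⟩ := hrec i hi (σ s) hsΩ g htest
    refine ⟨z, hz, (hjoin.trans hjz).mono ?_ ((add_le_add hcost le_rfl).trans ?_)⟩
    · have h1 : infDist (σ s) Ωᶜ ≤ 1 / 2 * d := hds3.trans (by gcongr)
      have h2 : 2 * νP * νH * infDist (σ s) Ωᶜ ≤ 2 * νP * νH * (1 / 2 * d) := by gcongr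
      linarith
    · rw [← ENNReal.ofReal_add (by positivity) (by positivity)]
      refine ENNReal.ofReal_le_ofReal ?_
      have h1 : Cα * (M ^ i * τ) * infDist (σ s) Ωᶜ ≤ Cα / 2 * τ * d := by
        calc Cα * (M ^ i * τ) * infDist (σ s) Ωᶜ
            ≤ Cα * (M ^ i * τ) * (3 * κP * δ / M ^ i * d) := by gcongr
          _ = Cα * τ * (3 * κP * δ) * d := by field_simp
          _ ≤ Cα * τ * (1 / 2) * d := by gcongr
          _ = _ := by ring
      linarith

end Improvement

/-! ### Scaling, choice of parameters, and conclusion -/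

section Scaling

open Metric

variable {X : Type*} [MetricSpace X] [MeasurableSpace X] {μ : Measure X} {Ω : Set X} {w : X → ℝ≥0∞}

theorem weightedAverage_const_mul {p : ℝ} (hp : 0 < p) {c : ℝ} (hc : 0 ≤ c) (g : X → ℝ) (x : X)
    (r : ℝ) : weightedAverage μ w p (fun y => c * g y) x r
      = ENNReal.ofReal c * weightedAverage μ w p g x r := by
  have h1 : ∀ y, ‖c * g y‖ₑ ^ p * w y = ENNReal.ofReal c ^ p * (‖g y‖ₑ ^ p * w y) := fun y => by
    rw [enorm_mul, Real.enorm_of_nonneg hc, ENNReal.mul_rpow_of_nonneg _ _ hp.le, mul_assoc]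
  unfold weightedAverage
  simp only [h1]
  rw [lintegral_const_mul' _ _ (ENNReal.rpow_ne_top_of_nonneg hp.le ENNReal.ofReal_ne_top),
    mul_div_assoc, ENNReal.mul_rpow_of_nonneg _ _ (by positivity), ← ENNReal.rpow_mul,
    mul_one_div_cancel hp.ne', ENNReal.rpow_one]

theorem maximalFunction_const_mul {p : ℝ} (hp : 0 < p) {c : ℝ} (hc : 0 ≤ c) (κ : ℝ) (g : X → ℝ)
    (x : X) : maximalFunction μ Ω w p κ (fun y => c * g y) x
      = ENNReal.ofReal c * maximalFunction μ Ω w p κ g x := by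
  simp only [maximalFunction, weightedAverage_const_mul hp hc, ENNReal.mul_iSup]

theorem RectCurve.lineIntegral_const_mul {X : Type*} [MetricSpace X] (γ : RectCurve X)
    {c : ℝ} (hc : 0 ≤ c) (g : X → ℝ) :
    γ.lineIntegral (fun y => c * g y) = ENNReal.ofReal c * γ.lineIntegral g := by
  simp only [RectCurve.lineIntegral, ENNReal.ofReal_mul hc]
  exact lintegral_const_mul' _ _ ENNReal.ofReal_ne_top

/-- A linear bound on `α` yields the Hardy inequality with the same constants, by applying it to
multiples of `g` with values in `[0, 1]`. -/
theorem hardy_of_alphaFunction_le {p ν κ C : ℝ} (hp : 0 < p) (hC : 0 < C)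
    (h : ∀ τ : ℝ, 0 ≤ τ → alphaFunction μ Ω w p ν κ τ ≤ ENNReal.ofReal (C * τ)) {x : X}
    (hx : x ∈ Ω) (hd : 0 < infDist x Ωᶜ) {g : X → ℝ} (hg : LowerSemicontinuous g)
    (hg0 : ∀ y, 0 ≤ g y) (hgb : BddAbove (range g)) :
    (⨅ γ ∈ curvesToSet ν x Ωᶜ, γ.lineIntegral g) ≤
      ENNReal.ofReal C * ENNReal.ofReal (infDist x Ωᶜ) * maximalFunction μ Ω w p κ g x := by
  set m := maximalFunction μ Ω w p κ g x with hm
  -- for `m = ∞` the number `τ` below would be the junk value `0`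
  by_cases hmt : m = ∞
  · rw [hmt, ENNReal.mul_top]
    · exact le_top
    · exact mul_ne_zero (ENNReal.ofReal_pos.2 hC).ne' (ENNReal.ofReal_pos.2 hd).ne'
  obtain ⟨b, hb⟩ := hgb
  set B := max b 1 with hB
  have hB0 : 0 < B := zero_lt_one.trans_le (le_max_right _ _)
  have hB1 : 0 ≤ B⁻¹ := (inv_pos.2 hB0).le
  have hgB : ∀ y, g y ≤ B := fun y => (hb ⟨y, rfl⟩).trans (le_max_left _ _)
  have hmax := maximalFunction_const_mul (μ := μ) (Ω := Ω) (w := w) hp hB1 κ g x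
  rw [← hm] at hmax
  have hmt' : ENNReal.ofReal B⁻¹ * m ≠ ∞ := ENNReal.mul_ne_top ENNReal.ofReal_ne_top hmt
  set τ := (ENNReal.ofReal B⁻¹ * m).toReal with hτ
  have htest : (fun y => B⁻¹ * g y) ∈ testClass μ Ω w p κ τ x := by
    refine ⟨?_, ?_, fun y => ⟨mul_nonneg hB1 (hg0 y), ?_⟩⟩
    · exact (continuous_const.mul continuous_id).comp_lowerSemicontinuous hg
        fun s t hst => mul_le_mul_of_nonneg_left hst hB1
    · rw [hmax, hτ, ENNReal.ofReal_toReal hmt']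
    · rw [inv_mul_le_one₀ hB0]; exact hgB y
  have h1 : (⨅ γ ∈ curvesToSet ν x Ωᶜ, γ.lineIntegral fun y => B⁻¹ * g y)
      / ENNReal.ofReal (infDist x Ωᶜ) ≤ ENNReal.ofReal (C * τ) := by
    refine le_trans ?_ (h τ ENNReal.toReal_nonneg)
    exact le_iSup₂_of_le x hx (le_iSup₂_of_le _ htest le_rfl)
  rw [ENNReal.div_le_iff (ENNReal.ofReal_pos.2 hd).ne' ENNReal.ofReal_ne_top,
    ENNReal.ofReal_mul hC.le, hτ, ENNReal.ofReal_toReal hmt'] at h1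
  have h2 : ENNReal.ofReal B⁻¹ * (⨅ γ ∈ curvesToSet ν x Ωᶜ, γ.lineIntegral g)
      ≤ ⨅ γ ∈ curvesToSet ν x Ωᶜ, γ.lineIntegral fun y => B⁻¹ * g y := by
    refine le_iInf₂ fun γ hγ => ?_
    rw [γ.lineIntegral_const_mul hB1]
    gcongr
    exact iInf₂_le γ hγ
  refine (ENNReal.mul_le_mul_iff_right (a := ENNReal.ofReal B⁻¹)
    (ENNReal.ofReal_pos.2 (inv_pos.2 hB0)).ne' ENNReal.ofReal_ne_top).1 ((h2.trans h1).trans ?_)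
  exact le_of_eq (by ring)

theorem alphaFunction_le_of_hardy {p ν κ C : ℝ} (hC : 0 < C)
    (hHardy : ∀ g : X → ℝ, LowerSemicontinuous g → (∀ y, 0 ≤ g y) → BddAbove (range g) →
      ∀ x ∈ Ω, (⨅ γ ∈ curvesToSet ν x Ωᶜ, γ.lineIntegral g) ≤
          ENNReal.ofReal C * ENNReal.ofReal (infDist x Ωᶜ) * maximalFunction μ Ω w p κ g x)
    (τ : ℝ) : alphaFunction μ Ω w p ν κ τ ≤ ENNReal.ofReal (C * τ) := by
  refine iSup₂_le fun x hx => iSup₂_le fun g hg => ENNReal.div_le_of_le_mul ?_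
  obtain ⟨hlsc, hmax, h01⟩ := hg
  refine (hHardy g hlsc (fun y => (h01 y).1) ⟨1, ?_⟩ x hx).trans ?_
  · rintro _ ⟨y, rfl⟩
    exact (h01 y).2
  · calc _ ≤ ENNReal.ofReal C * ENNReal.ofReal (infDist x Ωᶜ) * ENNReal.ofReal τ := by gcongr
      _ = _ := by rw [ENNReal.ofReal_mul hC.le]; ring

theorem alphaFunction_mono {p ν κ τ τ' : ℝ} (h : τ ≤ τ') :
    alphaFunction μ Ω w p ν κ τ ≤ alphaFunction μ Ω w p ν κ τ' := by
  refine iSup₂_mono fun x _ => iSup₂_le fun g hg => ?_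
  exact le_iSup₂_of_le g ⟨hg.1, hg.2.1.trans (ENNReal.ofReal_le_ofReal h), hg.2.2⟩ le_rfl

open Filter Topology in
theorem alphaFunction_le_of_forall_pos {p ν κ C : ℝ}
    (h : ∀ τ : ℝ, 0 < τ → alphaFunction μ Ω w p ν κ τ ≤ ENNReal.ofReal (C * τ)) (τ : ℝ)
    (hτ : 0 ≤ τ) : alphaFunction μ Ω w p ν κ τ ≤ ENNReal.ofReal (C * τ) := by
  rcases hτ.eq_or_lt with rfl | hτ
  · have ht : Tendsto (fun ε : ℝ => ENNReal.ofReal (C * ε)) (𝓝[>] 0)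
        (𝓝 (ENNReal.ofReal (C * 0))) :=
      (ENNReal.continuous_ofReal.comp (continuous_const.mul continuous_id)).continuousWithinAt
    refine ge_of_tendsto ht ?_
    filter_upwards [self_mem_nhdsWithin] with ε hε
    exact (alphaFunction_mono (mem_Ioi.1 hε).le).trans (h ε hε)
  · exact h τ hτ

end Scaling

open Filter Topology in
/-- The number `k` of levels can be chosen so large that the gain `1 / k` from averaging beats the
factor `k ^ (1 / p)` by which the maximal function grows; this is where `p > 1` enters. -/
theorem exists_nat_rpow_le {p C a δ : ℝ} (hp : 1 < p) (ha : 0 ≤ a) (hδ : 0 < δ) :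
    ∃ k : ℕ, 1 ≤ k ∧ C * (k * a) ^ (1 / p) ≤ k * δ := by
  have hp' : 0 < 1 - 1 / p := by
    have : 1 / p < 1 := (div_lt_one (by linarith)).2 hp
    linarith
  have ht : Tendsto (fun k : ℕ => (k : ℝ) ^ (1 - 1 / p)) atTop atTop :=
    (tendsto_rpow_atTop hp').comp tendsto_natCast_atTop_atTop
  obtain ⟨k, hk1, hk⟩ :=
    ((eventually_ge_atTop 1).and (ht.eventually_ge_atTop (C * a ^ (1 / p) / δ))).exists
  refine ⟨k, hk1, ?_⟩
  have hk0 : (0 : ℝ) < k := by exact_mod_cast hk1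
  rw [div_le_iff₀ hδ] at hk
  calc C * (k * a) ^ (1 / p) = k ^ (1 / p) * (C * a ^ (1 / p)) := by
        rw [Real.mul_rpow hk0.le ha]; ring
    _ ≤ k ^ (1 / p) * ((k : ℝ) ^ (1 - 1 / p) * δ) := by gcongr
    _ = k * δ := by
        rw [← mul_assoc, ← Real.rpow_add hk0]
        congr 1
        rw [show 1 / p + (1 - 1 / p) = 1 by ring, Real.rpow_one]

open Filter Topology in
theorem exists_exponent_rpow_sub_le {a p₀ p : ℝ} (ha : 0 < a) (hp : p₀ < p) :
    ∃ q, p₀ < q ∧ q < p ∧ a ^ (p - q) ≤ 2 := by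
  have hc : Continuous fun q : ℝ => a ^ (p - q) :=
    continuous_const.rpow (by fun_prop) fun _ => Or.inl ha.ne'
  have ht : Tendsto (fun q : ℝ => a ^ (p - q)) (𝓝[<] p) (𝓝 1) := by
    have := hc.tendsto p
    rw [sub_self, Real.rpow_zero] at this
    exact this.mono_left nhdsWithin_le_nhds
  obtain ⟨q, hq, hq'⟩ :=
    ((ht.eventually_le_const (by norm_num : (1 : ℝ) < 2)).and (Ioo_mem_nhdsLT hp)).exists
  exact ⟨q, hq'.1, hq'.2, hq⟩

theorem theorem6p1 {X : Type*} [MetricSpace X] [MeasurableSpace X] [BorelSpace X]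
    (μ : Measure X) {D : ℝ} (hD : 1 < D) (hμ : IsDoublingMeasure μ D)
    {Cqc : ℝ} (hCqc : 1 ≤ Cqc) (hX : IsQuasiconvexSpace X Cqc)
    {Ω : Set X} (hΩ : IsOpen Ω) (hΩne : Ω.Nonempty) (hΩX : Ω ≠ univ)
    (w : X → ℝ≥0∞) {p₀ p : ℝ} (hp₀ : 1 < p₀) (hp : p₀ < p)
    (hw : IsSemilocallyDoubling μ Ω w)
    (hPoincare : IsPoincareWeight μ Cqc Ω w p₀)
    (hHardy : IsHardyWeight μ Cqc Ω w p) :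
    (∃ q : ℝ, p₀ < q ∧ q < p ∧
      (∃ N K Cα : ℝ, Cqc < N ∧ 1 < K ∧ 0 < Cα ∧
        ∀ τ : ℝ, 0 ≤ τ → alphaFunction μ Ω w q N K τ ≤ ENNReal.ofReal (Cα * τ)) ∧
      IsHardyWeight μ Cqc Ω w q) ∧
    (∃ ν κ Cα : ℝ, Cqc < ν ∧ 1 < κ ∧ 0 < Cα ∧
      ∀ τ : ℝ, 0 ≤ τ → alphaFunction μ Ω w p ν κ τ ≤ ENNReal.ofReal (Cα * τ)) := by
  obtain ⟨hweight, CP, νP, κP, hCP, hνP, hκP, hPoin⟩ := hPoincare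
  obtain ⟨-, CH, νH, κH, hCH, hνH, hκH, hHar⟩ := hHardy
  refine ⟨?_, νH, κH, CH, hνH, hκH, hCH, fun τ _ => alphaFunction_le_of_hardy hCH hHar τ⟩
  -- `3 * κH ≤ K` is what the weak type estimate needs, `κP ≤ K` the use of the Poincaré inequality
  set K := max (3 * κH) κP with hK
  have hK1 : 3 * κH ≤ K := le_max_left _ _
  have hK2 : κP ≤ K := le_max_right _ _
  have hK0 : 1 < K := hκP.trans_le hK2
  obtain ⟨D', hD', hW⟩ := hw.isDoublingIn (κ := 16 * K) (by linarith)
  set M := max 2 (D' ^ 3) with hM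
  have hM2 : 2 ≤ M := le_max_left _ _
  have hM0 : 0 < M := by linarith
  set δ := 1 / (6 * κP * K) with hδ
  have hδ0 : 0 < δ := by positivity
  obtain ⟨k, hk1, hk⟩ := exists_nat_rpow_le (p := p) (C := 4 * CH) (a := 2 * D' ^ 7) (by linarith)
    (by positivity) hδ0
  have hk0 : (0 : ℝ) < k := by exact_mod_cast hk1
  set H := 2 * (k * (2 * D' ^ 7)) ^ (1 / p) with hH
  have hbase : 0 < k * (2 * D' ^ 7) := by positivity
  have hDH : (2 : ℝ≥0∞) ^ p * (k * (2 * ENNReal.ofReal D' ^ 7)) ≤ ENNReal.ofReal H ^ p := by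
    have hp0 : p ≠ 0 := by linarith
    -- `H` is chosen so that `H ^ p = 2 ^ p * (k * (2 * D' ^ 7))`
    rw [hH, ENNReal.ofReal_mul two_pos.le, ENNReal.mul_rpow_of_nonneg _ _ (by linarith),
      ← ENNReal.ofReal_rpow_of_pos hbase, ← ENNReal.rpow_mul, one_div_mul_cancel hp0,
      ENNReal.rpow_one, ENNReal.ofReal_mul hk0.le, ENNReal.ofReal_mul two_pos.le,
      ENNReal.ofReal_pow (by linarith)]
    simp
  obtain ⟨q, hq0, hqp, hMq⟩ := exists_exponent_rpow_sub_le (pow_pos hM0 k) hp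
  -- a bridged curve has length at most `νP * νH * d(x, Ωᶜ)`, and the continuation from a point `y`
  -- with `d(y, Ωᶜ) ≤ d(x, Ωᶜ) / 2` doubles this at most
  set N := 2 * νP * νH with hN
  have hNC : Cqc < N := by nlinarith
  set Cα := max N (2 * (M ^ k * (νH + 5 * CP + 1))) with hCα
  have hCα1 : N ≤ Cα := le_max_left _ _
  have hCα0 : 0 < Cα := by linarith
  -- downward induction on the level, in steps of factor at least `M`
  have hcost : ∀ n : ℕ, ∀ τ : ℝ, 0 < τ → 1 ≤ M ^ n * τ →
      BoundaryCostLE μ Ω w q N K τ (Cα * τ) := by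
    intro n
    induction n with
    | zero =>
      intro τ _ h1
      exact boundaryCostLE_of_one_le hΩ hΩX hCqc hX hNC hCα1 (by simpa using h1)
    | succ n ih =>
      intro τ hτ h1
      refine boundaryCostLE_step hΩ hΩX hweight.measurable hp₀.le hq0.le hqp hCP (by linarith) hκP
        hCH (by linarith) hκH hPoin hHar hK1 hK2 hW hM2 (le_max_right _ _) hMq (H := H)
        (by positivity) hDH (by linarith) (le_max_right _ _) hτ fun i hi => ?_
      have hi1 : M ≤ M ^ i := le_self_pow₀ (by linarith)
        (by have := (Finset.mem_Icc.1 hi).1; omega)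
      refine ih _ (by positivity) (h1.trans ?_)
      rw [pow_succ, mul_assoc]
      gcongr
  have halpha_pos : ∀ τ : ℝ, 0 < τ → alphaFunction μ Ω w q N K τ ≤ ENNReal.ofReal (Cα * τ) := by
    intro τ hτ
    obtain ⟨n, hn⟩ := pow_unbounded_of_one_lt (1 / τ) (by linarith : 1 < M)
    rw [div_lt_iff₀ hτ] at hn
    exact alphaFunction_le_of_boundaryCostLE (by linarith) (by positivity) (hcost n τ hτ hn.le)
  have halpha := alphaFunction_le_of_forall_pos halpha_pos
  refine ⟨q, hq0, hqp, ⟨N, K, Cα, hNC, hK0, hCα0, halpha⟩, hweight, Cα, N, K, hCα0, hNC, hK0, ?_⟩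
  intro g hg hg0 hgb x hx
  exact hardy_of_alphaFunction_le (by linarith) hCα0 halpha hx (infDist_compl_pos hΩ hΩX hx)
    hg hg0 hgb
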